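/- Graphs are finite and may have parallel edges but no loops. Let $K_2^3$ be the graph with two vertices joined by three parallel edges. Definitions. A signature of a graph $G$ is a map $\sigma:E(G)\to\{\pm1\}$, with set of negative edges $N_\sigma=\{e:\sigma(e)=-1\}$. An orientation of $(G,\sigma)$ assigns to each half-edge $h$ a value $\tau(h)\in\{\pm1\}$ such that the two half-edges $h,h'$ of each edge $e$ satisfy $\tau(h)\tau(h')=-\sigma(e)$. For real $r\ge 2$, a nowhere-zero $r$-flow on $(G,\sigma)$ is a map $f:E(G)\to\mathbb R$ with $1\le|f(e)|\le r-1$ for all $e$ such that, for some orientation $\tau$, $\sum_{h}\tau(h)f(e_h)=0$ at every vertex $v$, where $h$ runs over the half-edges at $v$ and $e_h$ is the edge of $h$. The circular flow number $F_c((G,\sigma))$ is the infimum of all $r\ge2$ for which $(G,\sigma)$ has a nowhere-zero $r$-flow, and $\infty$ if there is none. A set $X\subseteq E(G)$ is $r$-minimal if $F_c((G,\sigma))=r$ for the signature $\sigma$ with $N_\sigma=X$, and $F_c((G,\sigma'))\ne r$ for every signature $\sigma'$ with $N_{\sigma'}\subsetneq X$. It is a smallest $r$-minimal set if moreover $|X|\le|X'|$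 for every $r$-minimal set $X'$. Let $\alpha(G)$ be the independence number of $G$. For a cubic graph $G$, the resistance $r(G)$ is the minimum cardinality of a colour class over all proper 4-edge-colourings of $G$ (colour classes may be empty), and the oddness $\omega(G)$ is the minimum number of odd circuits of a 2-factor of $G$. A snark is a bridgeless cubic graph that is not 3-edge-colourable. Theorem. Let $G$ be a cubic graph which has a 1-factor, and suppose that at least one connected component of $G$ is not $K_2^3$ (for connected $G$: $G\neq K_2^3$). Then for each $i\in\{3,4\}$ there is a smallest $i$-minimal set in $G$, and if $X_3$, $X_4$ are a smallest 3-minimal and a smallest 4-minimal set, then: 1) if $G$ is bipartite, then $|X_3|=0$ and $|X_4|=2$; 2) if $G$ is 3-edge-colourable and not bipartite, then $2\le|X_3|\le 3\left(\frac12|V(G)|-\alpha(G)\right)$ and $|X_4|=0$; 3.1) if $G$ is not 3-edge-colourable, then $r(G)\le|X_4|\le\omega(G)\le|X_3|\le\min\left\{3\left(\frac12|V(G)|-\alpha(G)\right),\frac12|V(G)|\right\}$; 3.2) if $G$ is a snark, then $r(G)\le|X_4|\le\omega(G)<|X_3|\le\min\left\{3\left(\frac12|V(G)|-\alpha(G)\right),\frac12|V(G)|\right\}$.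 -/

import Mathlib

open scoped Graph

namespace Graph

variable {α β : Type*}

/-! Graphs are Mathlib's multigraphs `Graph α β`; the definitions below are meant for finite
loopless ones, so that an edge incident with `v` has exactly one half-edge at `v`. -/

/-- Every vertex is incident with exactly three edges. -/
def IsCubic (G : Graph α β) : Prop :=
  ∀ v ∈ V(G), (G.incidenceSet v).ncard = 3

/-- `F` is the edge set of a `k`-factor (a spanning `k`-regular subgraph) of `G`. -/
def IsFactor (G : Graph α β) (k : ℕ) (F : Set β) : Prop :=
  F ⊆ E(G) ∧ ∀ v ∈ V(G), (G.incidenceSet v ∩ F).ncard = k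

/-- `G` is (a copy of) `K_2^3`: two vertices joined by three parallel edges. -/
def IsK23 (G : Graph α β) : Prop :=
  ∃ u v : α, u ≠ v ∧ E(G).ncard = 3 ∧ G = banana u v E(G)

/-- An edge is a bridge if its deletion disconnects its ends. -/
def IsBridge (G : Graph α β) (e : β) : Prop :=
  e ∈ E(G) ∧ ∀ u v, G.IsLink e u v → ¬ Relation.ReflTransGen (G.deleteEdges {e}).Adj u v

/-- `c` is a proper edge colouring of `G`: distinct edges with a common end get distinct
colours. -/
def IsProperEdgeColoring (G : Graph α β) {k : ℕ} (c : β → Fin k) : Prop :=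
  ∀ e f v, G.Inc e v → G.Inc f v → e ≠ f → c e ≠ c f

/-- `G` is `k`-edge-colourable. -/
def EdgeColorable (G : Graph α β) (k : ℕ) : Prop :=
  ∃ c : β → Fin k, G.IsProperEdgeColoring c

/-- A snark: a bridgeless cubic graph that is not 3-edge-colourable. -/
def IsSnark (G : Graph α β) : Prop :=
  G.IsCubic ∧ (∀ e, ¬ G.IsBridge e) ∧ ¬ G.EdgeColorable 3

/-- The resistance: the smallest cardinality of a colour class, over all proper
4-edge-colourings. -/
noncomputable def resistance (G : Graph α β) : ℕ :=
  sInf {n | ∃ c : β → Fin 4, G.IsProperEdgeColoring c ∧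
    ∃ i, n = {e | e ∈ E(G) ∧ c e = i}.ncard}

/-- The number of odd circuits of a 2-factor with edge set `F`. The circuits are the connected
components of the spanning subgraph with edge set `F`, and a circuit has as many edges as
vertices. -/
noncomputable def numOddCircuits (G : Graph α β) (F : Set β) : ℕ :=
  (G.restrict F).toSimpleGraph.oddComponents.ncard

/-- The oddness: the minimum number of odd circuits of a 2-factor. -/
noncomputable def oddness (G : Graph α β) : ℕ :=
  sInf {n | ∃ F, G.IsFactor 2 F ∧ n = G.numOddCircuits F}

/-! ### Signed graphs and flows

A signature is a function `σ : β → ℤˣ`, of which only the values on `E(G)` matter. A half-edge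
is a pair of an edge `e` and an end `v` of `e`; functions on half-edges are written
`τ : β → α → ℤˣ`, of which only the values `τ e v` with `G.Inc e v` matter. -/

/-- The set `N_σ` of negative edges. -/
def negEdges (G : Graph α β) (σ : β → ℤˣ) : Set β :=
  {e | e ∈ E(G) ∧ σ e = -1}

/-- `τ` is an orientation of the signed graph `(G, σ)`. -/
def IsOrientation (G : Graph α β) (σ : β → ℤˣ) (τ : β → α → ℤˣ) : Prop :=
  ∀ e u v, G.IsLink e u v → τ e u * τ e v = - σ e

/-- The boundary of `f` at `v` with respect to `τ`. -/
noncomputable def boundary (G : Graph α β) (τ : β → α → ℤˣ) (f : β → ℝ) (v : α) : ℝ :=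
  ∑ᶠ e ∈ G.incidenceSet v, ((τ e v : ℤ) : ℝ) * f e

/-- `f` is an `r`-flow with respect to the orientation `τ`. -/
def IsFlow (G : Graph α β) (τ : β → α → ℤˣ) (r : ℝ) (f : β → ℝ) : Prop :=
  (∀ e ∈ E(G), (1 ≤ |f e| ∧ |f e| ≤ r - 1) ∨ f e = 0) ∧ ∀ v ∈ V(G), G.boundary τ f v = 0

/-- `(G, σ)` admits a nowhere-zero `r`-flow. -/
def HasNowhereZeroFlow (G : Graph α β) (σ : β → ℤˣ) (r : ℝ) : Prop :=
  ∃ τ, G.IsOrientation σ τ ∧ ∃ f, G.IsFlow τ r f ∧ ∀ e ∈ E(G), f e ≠ 0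

/-- The circular flow number `F_c((G, σ))`, which is `⊤` if there is no nowhere-zero flow. -/
noncomputable def circularFlowNumber (G : Graph α β) (σ : β → ℤˣ) : EReal :=
  sInf {x | ∃ r : ℝ, 2 ≤ r ∧ G.HasNowhereZeroFlow σ r ∧ x = (r : EReal)}

/-- `X` is an `r`-minimal set of edges of `G`. -/
def IsMinimalSet (G : Graph α β) (r : ℝ) (X : Set β) : Prop :=
  (∃ σ, G.circularFlowNumber σ = (r : EReal) ∧ G.negEdges σ = X) ∧
    ∀ σ', G.negEdges σ' ⊂ X → G.circularFlowNumber σ' ≠ (r : EReal)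

/-- `X` is a smallest `r`-minimal set of `G`. -/
def IsSmallestMinimalSet (G : Graph α β) (r : ℝ) (X : Set β) : Prop :=
  G.IsMinimalSet r X ∧ ∀ X', G.IsMinimalSet r X' → X.ncard ≤ X'.ncard

end Graph

/-! ### Alternating signs on a union of two matchings -/

section Matchings

open Finset

/-! A flow is read as real values on half-edges, opposite at the two ends of a positive edge and
equal at the two ends of a negative one. At a cubic vertex two values share a sign and the third
balances them. If r < 4, all moduli are below 3, so the third has modulus at least 2 and the other
two have modulus less than 2. The sign of the large value splits the vertices into two classes, and
the negative edges are exactly those inside a class. So a flow number below 4 forces the negative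
set to be the complement of a cut (`HasFlow.isCutCompl`); conversely a 1-factor gives every such set
a 3-flow. Flow number 3 thus means `IsCutCompl`, and, the infimum being attained, flow number 4
means `HasFlow N 4` without `IsCutCompl N`.

Smallest 3-minimal sets are therefore minimum cut complements. The cut of a maximum independent set
gives one upper bound. Switching at a vertex shows that a minimum one is a matching, which gives the
other. A cut cannot contain all edges of an odd circuit, so each odd circuit of a 2-factor has its
own negative edge, and the oddness is a lower bound. In a bridgeless graph some 1-factor contains a
given negative edge (by Tutte's theorem); that edge lies on no circuit of the complementary
2-factor, so the inequality is strict.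

For 4, a smallest negative set is again a matching. Cutting its edges open and rounding the flow to
integers gives a 4-edge-colouring with this set as a colour class (`HasFlow.exists_coloring`), hence
the bound by the resistance. In the other direction, a 2-factor with few odd circuits carries a
4-flow with at most one negative edge per odd circuit (`IsPM.hasFlow_four`). This negative set must
also avoid being a cut complement: reversing the orientation of one odd circuit changes the choice
of its negative edge, and if no choice worked, every 1-factor edge at an odd circuit would be a
bridge, contradicting the choice of a smallest side of a bridge. In bipartite graphs explicit flows
with two negative edges on a path of the 2-factor play the same role. -/

/-- A fixed-point-free pair of involutions admits a sign that is reversed by both. -/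
theorem exists_sign_of_involutive_of_ne {D : Type*} {a b : D → D} (ha : Function.Involutive a)
    (hb : Function.Involutive b) (ha' : ∀ d, a d ≠ d) (hb' : ∀ d, b d ≠ d) :
    ∃ s : D → ℤˣ, ∀ d, s (a d) = - s d ∧ s (b d) = - s d := by
  classical
  let A : Equiv.Perm D := ha.toPerm
  let B : Equiv.Perm D := hb.toPerm
  have hA2 : A * A = 1 := by ext d; exact ha d
  have hB2 : B * B = 1 := by ext d; exact hb d
  let P : Equiv.Perm D := B * A
  have hAi : A⁻¹ = A := inv_eq_of_mul_eq_one_left hA2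
  have hPi : P⁻¹ = A * B := by
    refine inv_eq_of_mul_eq_one_left ?_
    calc A * B * (B * A) = A * (B * B) * A := by group
      _ = 1 := by rw [hB2, mul_one, hA2]
  have hconj : ∀ k : ℤ, A * P ^ k = P ^ (-k) * A := by
    intro k
    have h1 : A * P * A⁻¹ = P⁻¹ := by
      rw [hPi, hAi]
      calc A * (B * A) * A = A * B * (A * A) := by group
        _ = A * B := by rw [hA2, mul_one]
    have h2 : A * P ^ k * A⁻¹ = P ^ (-k) := by
      rw [← conj_zpow, h1, inv_zpow', ]
    rw [← h2]; group
  -- If `A d = P ^ k d`, then for k = 2j the point `P ^ j d` is fixed by a, and for k = 2j + 1 the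
  -- point `A (P ^ j d)` is fixed by b.
  have key : ∀ d, ¬ P.SameCycle d (A d) := by
    rintro d ⟨k, hk⟩
    rcases Int.even_or_odd' k with ⟨j, rfl | rfl⟩
    · refine ha' ((P ^ j) d) ?_
      have : (A * P ^ j) d = (P ^ (-j) * A) d := by rw [hconj]
      calc a ((P ^ j) d) = (P ^ (-j)) (A d) := this
        _ = (P ^ (-j) * P ^ (2 * j)) d := by rw [← hk]; rfl
        _ = (P ^ j) d := by rw [← zpow_add]; congr 2; ring
    · refine hb' (A ((P ^ j) d)) ?_
      have : (A * P ^ j) d = (P ^ (-j) * A) d := by rw [hconj]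
      have h2 : A ((P ^ j) d) = (P ^ (1 + j)) d :=
        calc A ((P ^ j) d) = (P ^ (-j)) (A d) := this
          _ = (P ^ (-j) * P ^ (2 * j + 1)) d := by rw [← hk]; rfl
          _ = (P ^ (1 + j)) d := by rw [← zpow_add]; congr 2; ring
      rw [h2, zpow_one_add]
      change B (P ((P ^ j) d)) = P ((P ^ j) d)
      change (B * (B * A)) ((P ^ j) d) = _
      rw [← mul_assoc, hB2, one_mul, h2, zpow_one_add]
      rfl
  -- Both a and b interchange the cycle of d with one other cycle, the same for both. Any linear
  -- order on the cycles then decides which member of such a pair is positive.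
  let Q := Quotient (Equiv.Perm.SameCycle.setoid P)
  let q : D → Q := fun d => Quotient.mk _ d
  let _ : LinearOrder Q := linearOrderOfSTO (WellOrderingRel (α := Q))
  have hqne : ∀ d, q d ≠ q (a d) := fun d h => key d (Quotient.exact h)
  have hqb : ∀ d, q (b d) = q (a d) := by
    intro d
    refine Quotient.sound (?_ : P.SameCycle (b d) (a d))
    refine Equiv.Perm.SameCycle.symm ⟨1, ?_⟩
    change B (A (A d)) = B d
    rw [show A (A d) = d from ha d]
  have hqab : ∀ d, q (a (b d)) = q d := by
    intro d
    refine Quotient.sound (?_ : P.SameCycle (a (b d)) d)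
    refine ⟨1, ?_⟩
    change B (A (A (B d))) = d
    rw [show A (A (B d)) = B d from ha _]
    exact hb d
  refine ⟨fun d => if q d < q (a d) then 1 else -1, fun d => ⟨?_, ?_⟩⟩
  · rcases lt_or_gt_of_ne (hqne d) with h | h
    · simp [ha d, h, h.not_gt]
    · simp [ha d, h, h.not_gt]
  · simp only [hqb, hqab]
    rcases lt_or_gt_of_ne (hqne d) with h | h
    · simp [h, h.not_gt]
    · simp [h, h.not_gt]

/-- Two involutions admit a sign that each of them reverses off its fixed points. -/
theorem exists_sign_of_involutive {D : Type*} {a b : D → D} (ha : Function.Involutive a)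
    (hb : Function.Involutive b) :
    ∃ s : D → ℤˣ, ∀ d, (a d ≠ d → s (a d) = - s d) ∧ (b d ≠ d → s (b d) = - s d) := by
  classical
  -- Two copies of D, with fixed points sent to the other copy, make the involutions fixed-point
  -- free.
  let dbl : (D → D) → D × Bool → D × Bool :=
    fun c p => if c p.1 = p.1 then (p.1, !p.2) else (c p.1, p.2)
  have hinv : ∀ c : D → D, Function.Involutive c → Function.Involutive (dbl c) := by
    rintro c hc ⟨d, i⟩
    by_cases h : c d = d
    · simp [dbl, h]
    · simp [dbl, h, hc d, Ne.symm h]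
  have hne : ∀ (c : D → D) p, dbl c p ≠ p := by
    rintro c ⟨d, i⟩
    by_cases h : c d = d <;> simp [dbl, h]
  obtain ⟨s, hs⟩ := exists_sign_of_involutive_of_ne (hinv a ha) (hinv b hb) (hne a) (hne b)
  refine ⟨fun d => s (d, true), fun d => ⟨fun h => ?_, fun h => ?_⟩⟩
  · simpa [dbl, h] using (hs (d, true)).1
  · simpa [dbl, h] using (hs (d, true)).2

/-- The union of two (partial) matchings is bipartite. -/
theorem exists_sign_of_matchings {D : Type*} {R S : D → D → Prop}
    (hR : ∀ x y, R x y → R y x) (hR' : ∀ x y z, R x y → R x z → y = z) (hRi : ∀ x, ¬ R x x)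
    (hS : ∀ x y, S x y → S y x) (hS' : ∀ x y z, S x y → S x z → y = z) (hSi : ∀ x, ¬ S x x) :
    ∃ s : D → ℤˣ, (∀ x y, R x y → s y = - s x) ∧ (∀ x y, S x y → s y = - s x) := by
  classical
  have main : ∀ T : D → D → Prop, (∀ x y, T x y → T y x) →
      (∀ x y z, T x y → T x z → y = z) → ∃ a : D → D, Function.Involutive a ∧
        ∀ x y, T x y → a x = y := by
    intro T h1 h2
    let a : D → D := fun x => if h : ∃ y, T x y then h.choose else x
    have ha : ∀ x y, T x y → a x = y := by
      intro x y h
      have hx : ∃ y, T x y := ⟨y, h⟩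
      simp only [a, dif_pos hx]
      exact h2 _ _ _ hx.choose_spec h
    refine ⟨a, fun x => ?_, ha⟩
    by_cases hx : ∃ y, T x y
    · obtain ⟨y, hy⟩ := hx
      rw [ha x y hy, ha y x (h1 _ _ hy)]
    · have : a x = x := by simp only [a, dif_neg hx]
      rw [this, this]
  obtain ⟨a, ha, haR⟩ := main R hR hR'
  obtain ⟨b, hb, hbS⟩ := main S hS hS'
  obtain ⟨s, hs⟩ := exists_sign_of_involutive ha hb
  refine ⟨s, fun x y h => ?_, fun x y h => ?_⟩
  · have := (hs x).1
    rw [haR x y h] at this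
    exact this (by rintro rfl; exact hRi _ h)
  · have := (hs x).2
    rw [hbS x y h] at this
    exact this (by rintro rfl; exact hSi _ h)

/-! ### Integrality of the transportation polytope -/

/-- If every fibre of `p` that meets `D` meets it twice, then `p` at least halves `D`. -/
theorem two_mul_card_image_le {D A : Type*} [DecidableEq A] (s : Finset D) (p : D → A)
    (h : ∀ d ∈ s, ∃ d' ∈ s, d' ≠ d ∧ p d' = p d) : 2 * (s.image p).card ≤ s.card := by
  classical
  refine mul_card_image_le_card s 2 ?_
  intro a ha
  obtain ⟨d, hd, rfl⟩ := mem_image.1 ha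
  obtain ⟨d', hd', hne, hp⟩ := h d hd
  exact one_lt_card.2 ⟨d', by simp [hd', hp], d, by simp [hd], hne⟩

/-- A lone non-integral coordinate in a fibre with sum zero would equal minus a sum of integers. -/
theorem exists_ne_of_sum_fiber_eq_zero {D A : Type*} [Fintype D] [DecidableEq A] {p : D → A}
    {x : D → ℝ} (hx : ∀ a, ∑ d with p d = a, x d = 0) {d : D} (hd : ∀ n : ℤ, x d ≠ n) :
    ∃ d', (∀ n : ℤ, x d' ≠ n) ∧ d' ≠ d ∧ p d' = p d := by
  classical
  by_contra! hcon
  have hint : ∀ d' ∈ (univ.filter (fun d' => p d' = p d)).erase d, ∃ n : ℤ, x d' = n := by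
    intro d' hd'
    simp only [mem_erase, mem_filter, mem_univ, true_and] at hd'
    by_contra! h
    exact hcon d' h hd'.1 hd'.2
  choose! n hn using hint
  have h := hx (p d)
  rw [← add_sum_erase _ _ (show d ∈ univ.filter (fun d' => p d' = p d) by simp),
    sum_congr rfl hn] at h
  refine hd (- ∑ d' ∈ (univ.filter (fun d' => p d' = p d)).erase d, n d') ?_
  push_cast
  linarith

/-- A nonzero vector supported on `s` with vanishing fibre sums for two maps, when every fibre of
either map meeting `s` does so twice. -/
theorem exists_ne_zero_sum_fiber_eq_zero {D A B : Type*} [Fintype D] [DecidableEq A] [DecidableEq B]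
    (p : D → A) (q : D → B) (s : Finset D) (hs : s.Nonempty)
    (hp : ∀ d ∈ s, ∃ d' ∈ s, d' ≠ d ∧ p d' = p d) (hq : ∀ d ∈ s, ∃ d' ∈ s, d' ≠ d ∧ q d' = q d) :
    ∃ c : D → ℝ, c ≠ 0 ∧ (∀ d, d ∉ s → c d = 0) ∧ (∀ a, ∑ d with p d = a, c d = 0) ∧
      ∀ b, ∑ d with q d = b, c d = 0 := by
  classical
  obtain ⟨d₀, hd₀⟩ := hs
  let ext : (s → ℝ) → D → ℝ := fun y d => if h : d ∈ s then y ⟨d, h⟩ else 0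
  -- The constraint of the fibre of `q d₀` is dropped: it follows from the others, because both
  -- families of fibres have the same total. The at most |s| constraints thus become at most |s| -
  -- 1, and a kernel vector exists.
  let K := (s.image p : Finset A) ⊕ ((s.image q).erase (q d₀) : Finset B)
  let T : (s → ℝ) →ₗ[ℝ] (K → ℝ) :=
    { toFun := fun y => Sum.elim (fun a => ∑ d with p d = a, ext y d)
        (fun b => ∑ d with q d = b, ext y d)
      map_add' := by
        intro y z
        have : ∀ d, ext (y + z) d = ext y d + ext z d := by
          intro d; by_cases h : d ∈ s <;> simp [ext, h]
        ext (k | k) <;> simp [this, sum_add_distrib]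
      map_smul' := by
        intro r y
        have : ∀ d, ext (r • y) d = r * ext y d := by
          intro d; by_cases h : d ∈ s <;> simp [ext, h]
        ext (k | k) <;> simp [this, mul_sum] }
  have hlt : Module.finrank ℝ (K → ℝ) < Module.finrank ℝ (s → ℝ) := by
    have h1 := two_mul_card_image_le s p hp
    have h2 := two_mul_card_image_le s q hq
    have h3 : q d₀ ∈ s.image q := mem_image_of_mem _ hd₀
    have h4 : 0 < (s.image q).card := card_pos.2 ⟨_, h3⟩
    simp only [Module.finrank_fintype_fun_eq_card, K, Fintype.card_sum, Fintype.card_coe,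
      card_erase_of_mem h3]
    omega
  obtain ⟨y, hy, hy0⟩ := Submodule.exists_mem_ne_zero_of_ne_bot (T.ker_ne_bot_of_finrank_lt hlt)
  have hT : T y = 0 := hy
  have hsupp : ∀ d, d ∉ s → ext y d = 0 := fun d hd => by simp [ext, hd]
  have hA : ∀ a, ∑ d with p d = a, ext y d = 0 := by
    intro a
    by_cases ha : a ∈ s.image p
    · exact congrFun hT (Sum.inl ⟨a, ha⟩)
    · refine sum_eq_zero fun d hd => hsupp d fun hds => ha ?_
      rw [← (mem_filter.1 hd).2]
      exact mem_image_of_mem _ hds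
  have hB : ∀ b, b ≠ q d₀ → ∑ d with q d = b, ext y d = 0 := by
    intro b hb0
    by_cases hb : b ∈ s.image q
    · exact congrFun hT (Sum.inr ⟨b, mem_erase.2 ⟨hb0, hb⟩⟩)
    · refine sum_eq_zero fun d hd => hsupp d fun hds => hb ?_
      rw [← (mem_filter.1 hd).2]
      exact mem_image_of_mem _ hds
  have htot : ∑ d, ext y d = 0 := by
    rw [← sum_fiberwise_of_maps_to (g := p) (t := univ.image p)
      (fun d _ => mem_image_of_mem _ (mem_univ d))]
    exact sum_eq_zero fun a _ => hA a
  refine ⟨ext y, ?_, hsupp, hA, fun b => ?_⟩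
  · intro h
    refine hy0 (funext fun d => ?_)
    have := congrFun h d.1
    simpa [ext] using this
  · by_cases hb : b = q d₀
    · subst hb
      rw [← sum_fiberwise_of_maps_to (g := q) (t := univ.image q)
        (fun d _ => mem_image_of_mem _ (mem_univ d)),
        sum_eq_single_of_mem (q d₀) (mem_image_of_mem _ (mem_univ _)) (fun b _ => hB b)] at htot
      exact htot
    · exact hB b hb

/-- Integrality of the transportation polytope. -/
theorem exists_int_of_sum_fiber_eq_zero {D A B : Type*} [Fintype D] [DecidableEq A] [DecidableEq B]
    (p : D → A) (q : D → B) (g : D → ℝ) (l u : D → ℤ) (hl : ∀ d, l d ≤ g d) (hu : ∀ d, g d ≤ u d)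
    (hp : ∀ a, ∑ d with p d = a, g d = 0) (hq : ∀ b, ∑ d with q d = b, g d = 0) :
    ∃ z : D → ℤ, (∀ d, l d ≤ z d ∧ z d ≤ u d) ∧ (∀ a, ∑ d with p d = a, z d = 0) ∧
      ∀ b, ∑ d with q d = b, z d = 0 := by
  classical
  let K : Set (D → ℝ) := Set.Icc (fun d => (l d : ℝ)) (fun d => (u d : ℝ)) ∩
    {x | (∀ a, ∑ d with p d = a, x d = 0) ∧ ∀ b, ∑ d with q d = b, x d = 0}
  have hK : IsCompact K := by
    refine isCompact_Icc.inter_right ?_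
    simp only [Set.ofPred_and, Set.ofPred_forall]
    refine (isClosed_iInter fun a => ?_).inter (isClosed_iInter fun b => ?_)
    · exact isClosed_eq (by fun_prop) (by fun_prop)
    · exact isClosed_eq (by fun_prop) (by fun_prop)
  -- An extreme point is integral: otherwise it is the midpoint of two points moved along a vector
  -- supported on its non-integral coordinates.
  obtain ⟨x, hxK, hx⟩ := hK.extremePoints_nonempty ⟨g, ⟨hl, hu⟩, hp, hq⟩
  obtain ⟨⟨hxl, hxu⟩, hxp, hxq⟩ := hxK
  by_cases hint : ∀ d, ∃ n : ℤ, x d = n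
  · choose z hz using hint
    refine ⟨z, fun d => ⟨?_, ?_⟩, fun a => ?_, fun b => ?_⟩
    · have := hxl d
      simp only [hz] at this
      exact_mod_cast this
    · have := hxu d
      simp only [hz] at this
      exact_mod_cast this
    · have := hxp a
      simp only [hz] at this
      exact_mod_cast this
    · have := hxq b
      simp only [hz] at this
      exact_mod_cast this
  exfalso
  push Not at hint
  obtain ⟨d₀, hd₀⟩ := hint
  let s : Finset D := univ.filter fun d => ∀ n : ℤ, x d ≠ n
  obtain ⟨c, hc0, hcs, hcp, hcq⟩ := exists_ne_zero_sum_fiber_eq_zero p q s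
    ⟨d₀, by simpa [s] using hd₀⟩
    (fun d hd => by simpa [s] using exists_ne_of_sum_fiber_eq_zero hxp (by simpa [s] using hd))
    (fun d hd => by simpa [s] using exists_ne_of_sum_fiber_eq_zero hxq (by simpa [s] using hd))
  -- A non-integral coordinate lies strictly between its integral bounds, so a small move stays
  -- within them.
  have hev : ∀ᶠ ε : ℝ in nhdsWithin 0 (Set.Ioi 0), ∀ d,
      ε * |c d| ≤ x d - l d ∧ ε * |c d| ≤ u d - x d := by
    refine Filter.eventually_all.2 fun d => ?_
    by_cases hd : d ∈ s
    · have hd' : ∀ n : ℤ, x d ≠ n := by simpa [s] using hd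
      have h1 : 0 < x d - l d := sub_pos.2 (lt_of_le_of_ne (hxl d) (hd' _).symm)
      have h2 : 0 < u d - x d := sub_pos.2 (lt_of_le_of_ne (hxu d) (hd' _))
      have ht : Filter.Tendsto (fun ε : ℝ => ε * |c d|) (nhdsWithin 0 (Set.Ioi 0)) (nhds 0) := by
        have : Continuous fun ε : ℝ => ε * |c d| := by fun_prop
        simpa using (this.tendsto 0).mono_left nhdsWithin_le_nhds
      filter_upwards [ht.eventually (gt_mem_nhds h1), ht.eventually (gt_mem_nhds h2)]
        with ε h3 h4 using ⟨h3.le, h4.le⟩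
    · refine Filter.Eventually.of_forall fun ε => ?_
      rw [hcs d hd]
      have h1 := hxl d
      have h2 := hxu d
      simp only at h1 h2
      constructor <;> simp <;> linarith
  obtain ⟨ε, hε, hε0⟩ := (hev.and self_mem_nhdsWithin).exists
  have hε0 : 0 < ε := hε0
  have hmem : ∀ r : ℝ, |r| = ε → x + r • c ∈ K := by
    intro r hr
    refine ⟨⟨fun d => ?_, fun d => ?_⟩, fun a => ?_, fun b => ?_⟩
    · have h1 := (hε d).1
      rw [← hr, ← abs_mul] at h1
      have := neg_abs_le (r * c d)
      simp only [Pi.add_apply, Pi.smul_apply, smul_eq_mul]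
      linarith
    · have h1 := (hε d).2
      rw [← hr, ← abs_mul] at h1
      have := le_abs_self (r * c d)
      simp only [Pi.add_apply, Pi.smul_apply, smul_eq_mul]
      linarith
    · simp [sum_add_distrib, ← mul_sum, hxp, hcp]
    · simp [sum_add_distrib, ← mul_sum, hxq, hcq]
  have h1 := hx (hmem ε (abs_of_pos hε0)) (hmem (-ε) (by rw [abs_neg, abs_of_pos hε0]))
    ⟨1 / 2, 1 / 2, by norm_num, by norm_num, by norm_num, by
      ext d; simp; ring⟩
  have h2 : ε • c = 0 := by simpa using h1
  exact hc0 ((smul_eq_zero.1 h2).resolve_left hε0.ne')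

end Matchings

/-! ### Cubic incidence structures and counting across cuts -/

/-- A loopless cubic multigraph on fixed vertex and edge types, given by its incidence relation. -/
structure CubicMultigraph (V E : Type*) where
  inc : E → V → Prop
  exists_ends : ∀ e, ∃ u v, u ≠ v ∧ ∀ w, inc e w ↔ w = u ∨ w = v
  exists_edges : ∀ v, ∃ e f g, e ≠ f ∧ e ≠ g ∧ f ≠ g ∧ ∀ x, inc x v ↔ x = e ∨ x = f ∨ x = g

namespace CubicMultigraph

open Finset

open scoped Classical

set_option linter.unusedSectionVars false

variable {V E : Type*} (C : CubicMultigraph V E)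

/-- The end of `e` other than `v`. -/
noncomputable def other (e : E) (v : V) : V :=
  if h : ∃ u, u ≠ v ∧ C.inc e u then h.choose else v

variable {C} {e f : E} {u v w : V}

theorem other_spec (e : E) (v : V) : C.other e v ≠ v ∧ C.inc e (C.other e v) := by
  have h : ∃ u, u ≠ v ∧ C.inc e u := by
    obtain ⟨a, b, hab, h⟩ := C.exists_ends e
    by_cases hv : v = a
    · exact ⟨b, by simpa [hv] using hab.symm, by simp [h]⟩
    · exact ⟨a, Ne.symm hv, by simp [h]⟩
  rw [other, dif_pos h]
  exact h.choose_spec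

theorem other_ne (e : E) (v : V) : C.other e v ≠ v := (other_spec e v).1

theorem inc_other (e : E) (v : V) : C.inc e (C.other e v) := (other_spec e v).2

theorem inc_iff_of_inc (hu : C.inc e u) (hv : C.inc e v) (huv : u ≠ v) :
    C.inc e w ↔ w = u ∨ w = v := by
  obtain ⟨a, b, hab, h⟩ := C.exists_ends e
  rw [h] at hu hv ⊢
  grind

theorem inc_iff_other (hv : C.inc e v) : C.inc e w ↔ w = v ∨ w = C.other e v :=
  inc_iff_of_inc hv (inc_other e v) (other_ne e v).symm

theorem other_eq (hv : C.inc e v) (hw : C.inc e w) (hne : w ≠ v) : C.other e v = w :=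
  (((inc_iff_other hv).1 hw).resolve_left hne).symm

theorem other_other (hv : C.inc e v) : C.other e (C.other e v) = v :=
  other_eq (inc_other e v) hv (other_ne e v).symm

variable [Fintype V] [Fintype E]

variable (C) in
/-- The edges incident with `v`. -/
noncomputable def edgesAt (v : V) : Finset E := univ.filter (C.inc · v)

variable (C) in
/-- The ends of `e`. -/
noncomputable def ends (e : E) : Finset V := univ.filter (C.inc e ·)

@[simp] theorem mem_edgesAt : e ∈ C.edgesAt v ↔ C.inc e v := by simp [edgesAt]

@[simp] theorem mem_ends : v ∈ C.ends e ↔ C.inc e v := by simp [ends]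

theorem card_edgesAt (v : V) : (C.edgesAt v).card = 3 := by
  obtain ⟨e, f, g, h1, h2, h3, h⟩ := C.exists_edges v
  exact card_eq_three.2 ⟨e, f, g, h1, h2, h3, by ext x; simp [h]⟩

theorem ends_eq (hu : C.inc e u) (hv : C.inc e v) (huv : u ≠ v) : C.ends e = {u, v} := by
  ext w; simp [inc_iff_of_inc hu hv huv]

theorem ends_eq_other (hv : C.inc e v) : C.ends e = {v, C.other e v} :=
  ends_eq hv (inc_other e v) (other_ne e v).symm

theorem exists_inc (e : E) : ∃ v, C.inc e v := by
  obtain ⟨a, b, hab, h⟩ := C.exists_ends e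
  exact ⟨a, by simp [h]⟩

theorem sum_edgesAt_comm {M : Type*} [AddCommMonoid M] (S : Finset V) (Y : Finset E)
    (g : E → V → M) :
    ∑ v ∈ S, ∑ e ∈ C.edgesAt v ∩ Y, g e v = ∑ e ∈ Y, ∑ v ∈ C.ends e ∩ S, g e v := by
  refine sum_comm' ?_
  intro v e
  simp only [mem_inter, mem_edgesAt, mem_ends]
  tauto

variable (C) in
/-- The edges with exactly one end in `S`. -/
noncomputable def cut (S : Finset V) : Finset E :=
  univ.filter fun e => ∃ u v, C.inc e u ∧ C.inc e v ∧ u ∈ S ∧ v ∉ S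

variable (C) in
/-- The edges with both ends in `S`. -/
noncomputable def inside (S : Finset V) : Finset E :=
  univ.filter fun e => ∀ v, C.inc e v → v ∈ S

theorem mem_cut {S : Finset V} : e ∈ C.cut S ↔ ∃ u v, C.inc e u ∧ C.inc e v ∧ u ∈ S ∧ v ∉ S := by
  simp [cut]

theorem mem_inside {S : Finset V} : e ∈ C.inside S ↔ ∀ v, C.inc e v → v ∈ S := by
  simp [inside]

theorem mem_cut_iff {S : Finset V} (hu : C.inc e u) (hv : C.inc e v) (huv : u ≠ v) :
    e ∈ C.cut S ↔ ¬ (u ∈ S ↔ v ∈ S) := by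
  rw [mem_cut]
  constructor
  · rintro ⟨a, b, ha, hb, haS, hbS⟩ h
    rw [inc_iff_of_inc hu hv huv] at ha hb
    grind
  · intro h
    by_cases hS : u ∈ S
    · exact ⟨u, v, hu, hv, hS, by tauto⟩
    · exact ⟨v, u, hv, hu, by tauto, hS⟩

theorem mem_cut_iff_other {S : Finset V} (hv : C.inc e v) :
    e ∈ C.cut S ↔ ¬ (v ∈ S ↔ C.other e v ∈ S) :=
  mem_cut_iff hv (inc_other e v) (other_ne e v).symm

theorem mem_inside_iff_other {S : Finset V} (hv : C.inc e v) :
    e ∈ C.inside S ↔ v ∈ S ∧ C.other e v ∈ S := by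
  rw [mem_inside]
  simp [inc_iff_other hv]

theorem cut_symmDiff (S T : Finset V) : C.cut (symmDiff S T) = symmDiff (C.cut S) (C.cut T) := by
  ext e
  obtain ⟨v, hv⟩ := exists_inc (C := C) e
  simp only [mem_symmDiff, mem_cut_iff_other hv]
  tauto

theorem cut_compl (S : Finset V) : C.cut Sᶜ = C.cut S := by
  ext e
  obtain ⟨v, hv⟩ := exists_inc (C := C) e
  simp only [mem_compl, mem_cut_iff_other hv]
  tauto

theorem cut_singleton (v : V) : C.cut {v} = C.edgesAt v := by
  ext e
  obtain ⟨w, hw⟩ := exists_inc (C := C) e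
  simp only [mem_singleton, mem_cut_iff_other hw, mem_edgesAt, inc_iff_other hw]
  have := other_ne (C := C) e w
  grind

/-- Counting the incidences between `S` and `Y`. -/
theorem sum_card_edgesAt_inter (S : Finset V) (Y : Finset E) :
    ∑ v ∈ S, (C.edgesAt v ∩ Y).card = (C.cut S ∩ Y).card + 2 * (C.inside S ∩ Y).card := by
  simp only [card_eq_sum_ones, sum_edgesAt_comm]
  have : ∀ e ∈ Y, ∑ v ∈ C.ends e ∩ S, 1 =
      (if e ∈ C.cut S then 1 else 0) + 2 * (if e ∈ C.inside S then 1 else 0) := by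
    intro e _
    obtain ⟨v, hv⟩ := exists_inc (C := C) e
    have hne := (other_ne (C := C) e v).symm
    rw [← card_eq_sum_ones, ends_eq_other hv]
    simp only [mem_cut_iff_other hv, mem_inside_iff_other hv]
    by_cases h1 : v ∈ S <;> by_cases h2 : C.other e v ∈ S <;>
      simp [h1, h2, hne]
  rw [sum_congr rfl this, sum_add_distrib, ← mul_sum]
  simp only [sum_boole, inter_comm _ Y, ← filter_mem_eq_inter]
  simp

/-- The handshake identity makes |S| and its cut have the same parity, on which the later bridge
arguments rest. -/
theorem three_mul_card (S : Finset V) : 3 * S.card = (C.cut S).card + 2 * (C.inside S).card := by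
  have := sum_card_edgesAt_inter (C := C) S univ
  simpa [card_edgesAt, mul_comm] using this

theorem three_mul_card_univ (C : CubicMultigraph V E) :
    3 * Fintype.card V = 2 * Fintype.card E := by
  have h := three_mul_card (C := C) univ
  have h1 : C.cut univ = ∅ := by ext; simp [mem_cut]
  have h2 : C.inside univ = univ := by ext; simp [mem_inside]
  simpa [h1, h2] using h

theorem compl_cut (S : Finset V) : (C.cut S)ᶜ = C.inside S ∪ C.inside Sᶜ := by
  ext e
  obtain ⟨v, hv⟩ := exists_inc (C := C) e
  simp only [mem_compl, mem_union, mem_cut_iff_other hv, mem_inside_iff_other hv]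
  tauto

theorem card_compl_cut (S : Finset V) :
    (C.cut S)ᶜ.card = (C.inside S).card + (C.inside Sᶜ).card := by
  rw [compl_cut, card_union_of_disjoint]
  rw [disjoint_left]
  intro e h1 h2
  obtain ⟨v, hv⟩ := exists_inc (C := C) e
  simp only [mem_inside_iff_other hv, mem_compl] at h1 h2
  tauto

variable (C) in
/-- `M` is a perfect matching. -/
def IsPM (M : Finset E) : Prop := ∀ v, ∃! e, e ∈ M ∧ C.inc e v

/-- In a cubic graph two edges at a vertex, together with one more, are all the edges there. -/
theorem exists_third (h1 : C.inc e v) (h2 : C.inc f v) (h12 : e ≠ f) :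
    ∃ g, g ≠ e ∧ g ≠ f ∧ C.edgesAt v = {e, f, g} ∧ C.inc g v := by
  obtain ⟨a, b, c, hab, hac, hbc, h⟩ := C.exists_edges v
  have h1' := (h e).1 h1
  have h2' := (h f).1 h2
  have : ∃ g, g ≠ e ∧ g ≠ f ∧ ∀ x, C.inc x v ↔ x = e ∨ x = f ∨ x = g := by
    rcases h1' with rfl | rfl | rfl <;> rcases h2' with rfl | rfl | rfl
    all_goals first | exact absurd rfl h12 | skip
    · exact ⟨c, hac.symm, hbc.symm, h⟩
    · exact ⟨b, hab.symm, hbc, by grind⟩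
    · exact ⟨c, hbc.symm, hac.symm, by grind⟩
    · exact ⟨a, hab, hac, by grind⟩
    · exact ⟨b, hbc, hab.symm, by grind⟩
    · exact ⟨a, hac, hab, by grind⟩
  obtain ⟨g, hg1, hg2, hg⟩ := this
  exact ⟨g, hg1, hg2, by ext x; simp [hg], by simp [hg]⟩

/-- The edges at a vertex with respect to a perfect matching `M`. -/
theorem IsPM.edgesAt_eq {M : Finset E} (hM : C.IsPM M) (v : V) :
    ∃ m e f, m ∈ M ∧ e ∉ M ∧ f ∉ M ∧ m ≠ e ∧ m ≠ f ∧ e ≠ f ∧ C.edgesAt v = {m, e, f} ∧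
      ∀ x, C.inc x v ↔ x = m ∨ x = e ∨ x = f := by
  obtain ⟨m, ⟨hmM, hm⟩, huniq⟩ := hM v
  have hcard := card_edgesAt (C := C) v
  obtain ⟨e, he⟩ : ∃ e, e ∈ (C.edgesAt v).erase m := by
    refine card_pos.1 ?_
    rw [card_erase_of_mem (by simpa using hm)]
    omega
  simp only [mem_erase, mem_edgesAt] at he
  obtain ⟨f, hf1, hf2, hE, hf⟩ := exists_third hm he.2 he.1.symm
  refine ⟨m, e, f, hmM, fun h => he.1 (huniq e ⟨h, he.2⟩), fun h => hf1 (huniq f ⟨h, hf⟩),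
    he.1.symm, hf1.symm, hf2.symm, hE, fun x => ?_⟩
  rw [← mem_edgesAt, hE]
  simp

end CubicMultigraph

/-! ### Half-edge flows, flow number three and switching -/

namespace CubicMultigraph

open Finset

open scoped Classical

set_option linter.unusedSectionVars false

variable {V E : Type*} {C : CubicMultigraph V E} {e f : E} {u v w : V}
variable [Fintype V] [Fintype E] {N : Finset E} {r : ℝ}

/-- A nowhere-zero `r`-flow on the signed graph with set of negative edges `N`, given by its signed
values on the half-edges. -/
structure IsHalfEdgeFlow (C : CubicMultigraph V E) (N : Finset E) (r : ℝ) (g : E → V → ℝ) :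
    Prop where
  one_le : ∀ e v, C.inc e v → 1 ≤ |g e v|
  le : ∀ e v, C.inc e v → |g e v| ≤ r - 1
  neg : ∀ e u v, C.inc e u → C.inc e v → u ≠ v → e ∈ N → g e u = g e v
  pos : ∀ e u v, C.inc e u → C.inc e v → u ≠ v → e ∉ N → g e u = - g e v
  sum : ∀ v, ∑ e ∈ C.edgesAt v, g e v = 0

/-- The signed graph with set of negative edges `N` has a nowhere-zero `r`-flow. -/
def HasFlow (C : CubicMultigraph V E) (N : Finset E) (r : ℝ) : Prop :=
  ∃ g, C.IsHalfEdgeFlow N r g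

/-- `N` is the complement of a cut. -/
def IsCutCompl (C : CubicMultigraph V E) (N : Finset E) : Prop := ∃ S, N = (C.cut S)ᶜ

theorem HasFlow.mono {r' : ℝ} (h : C.HasFlow N r) (hr : r ≤ r') : C.HasFlow N r' := by
  obtain ⟨g, hg⟩ := h
  exact ⟨g, hg.one_le, fun e v he => (hg.le e v he).trans (by linarith), hg.neg, hg.pos, hg.sum⟩

/-- At any vertex one of the three values has modulus equal to the sum of the other two moduli,
hence at least 2. -/
theorem HasFlow.three_le [Nonempty V] (h : C.HasFlow N r) : 3 ≤ r := by
  obtain ⟨g, hg⟩ := h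
  obtain ⟨v⟩ := ‹Nonempty V›
  have hs := hg.sum v
  obtain ⟨a, b, c, hab, hac, hbc, hE⟩ := card_eq_three.1 (card_edgesAt (C := C) v)
  have hinc : ∀ x, x = a ∨ x = b ∨ x = c → C.inc x v := by
    intro x hx; rw [← mem_edgesAt, hE]; simpa using hx
  rw [hE, sum_insert (by simp [hab, hac]), sum_insert (by simp [hbc]), sum_singleton] at hs
  have h1 := hg.one_le a v (hinc a (by simp))
  have h2 := hg.one_le b v (hinc b (by simp))
  have h3 := hg.one_le c v (hinc c (by simp))
  have h4 := hg.le a v (hinc a (by simp))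
  have h5 := hg.le b v (hinc b (by simp))
  have h6 := hg.le c v (hinc c (by simp))
  rcases abs_cases (g a v) with ⟨ha, _⟩ | ⟨ha, _⟩ <;>
  rcases abs_cases (g b v) with ⟨hb, _⟩ | ⟨hb, _⟩ <;>
  rcases abs_cases (g c v) with ⟨hc, _⟩ | ⟨hc, _⟩ <;> linarith

/-- Two of the numbers share a sign, and the third is minus their sum: its modulus is at least 2.
Being less than 3, it leaves each of the other two a modulus less than 2. -/
theorem sign_pattern_of_lt_three {x y z : ℝ} (h : x + y + z = 0) (hx : 1 ≤ |x|) (hy : 1 ≤ |y|)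
    (hz : 1 ≤ |z|) (hx' : |x| < 3) (hy' : |y| < 3) (hz' : |z| < 3) :
    (∀ t, t = x ∨ t = y ∨ t = z → (2 ≤ |t| → t < 0) ∧ (|t| < 2 → 0 < t)) ∨
    (∀ t, t = x ∨ t = y ∨ t = z → (2 ≤ |t| → 0 < t) ∧ (|t| < 2 → t < 0)) := by
  simp only [forall_eq_or_imp, forall_eq]
  rcases abs_cases x with ⟨ha, ha'⟩ | ⟨ha, ha'⟩ <;>
  rcases abs_cases y with ⟨hb, hb'⟩ | ⟨hb, hb'⟩ <;>
  rcases abs_cases z with ⟨hc, hc'⟩ | ⟨hc, hc'⟩ <;>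
  rw [ha] at hx hx' ⊢ <;> rw [hb] at hy hy' ⊢ <;> rw [hc] at hz hz' ⊢ <;>
  first
  | (exfalso; linarith)
  | (left
     refine ⟨⟨fun _ => ?_, fun _ => ?_⟩, ⟨fun _ => ?_, fun _ => ?_⟩, fun _ => ?_, fun _ => ?_⟩ <;>
       linarith)
  | (right
     refine ⟨⟨fun _ => ?_, fun _ => ?_⟩, ⟨fun _ => ?_, fun _ => ?_⟩, fun _ => ?_, fun _ => ?_⟩ <;>
       linarith)

/-- The cut is given by the vertices at which the value of modulus at least 2 is negative. -/
theorem HasFlow.isCutCompl (h : C.HasFlow N r) (hr : r < 4) : C.IsCutCompl N := by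
  obtain ⟨g, hg⟩ := h
  let P : V → Prop := fun v => ∀ e, C.inc e v →
    (2 ≤ |g e v| → g e v < 0) ∧ (|g e v| < 2 → 0 < g e v)
  have hP : ∀ v, ¬ P v → ∀ e, C.inc e v →
      (2 ≤ |g e v| → 0 < g e v) ∧ (|g e v| < 2 → g e v < 0) := by
    intro v hv
    have hs := hg.sum v
    obtain ⟨a, b, c, hab, hac, hbc, hE⟩ := card_eq_three.1 (card_edgesAt (C := C) v)
    have hinc : ∀ x, C.inc x v ↔ x = a ∨ x = b ∨ x = c := by
      intro x; rw [← mem_edgesAt, hE]; simp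
    rw [hE, sum_insert (by simp [hab, hac]), sum_insert (by simp [hbc]), sum_singleton,
      ← add_assoc] at hs
    have ha := (hinc a).2 (by simp)
    have hb := (hinc b).2 (by simp)
    have hc := (hinc c).2 (by simp)
    have hlt : ∀ x, C.inc x v → |g x v| < 3 := fun x hx => by linarith [hg.le x v hx]
    rcases sign_pattern_of_lt_three hs (hg.one_le a v ha) (hg.one_le b v hb) (hg.one_le c v hc)
      (hlt a ha) (hlt b hb) (hlt c hc) with h | h
    · refine absurd (fun e he => h (g e v) ?_) hv
      rcases (hinc e).1 he with rfl | rfl | rfl <;> simp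
    · intro e he
      refine h (g e v) ?_
      rcases (hinc e).1 he with rfl | rfl | rfl <;> simp
  refine ⟨univ.filter P, ?_⟩
  ext e
  obtain ⟨u, hu⟩ := exists_inc (C := C) e
  have hw := inc_other (C := C) e u
  have hne := (other_ne (C := C) e u).symm
  rw [mem_compl, mem_cut_iff_other hu]
  generalize C.other e u = w at hw hne
  simp only [mem_filter, mem_univ, true_and, not_not]
  have h1 := hg.one_le e u hu
  -- The two values on an edge have equal modulus, so their signs agree exactly when the ends are of
  -- the same type.
  have key : ∀ x y : ℝ, |x| = |y| → ∀ a b : Prop,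
      (a → (2 ≤ |x| → x < 0) ∧ (|x| < 2 → 0 < x)) → (¬ a → (2 ≤ |x| → 0 < x) ∧ (|x| < 2 → x < 0)) →
      (b → (2 ≤ |y| → y < 0) ∧ (|y| < 2 → 0 < y)) → (¬ b → (2 ≤ |y| → 0 < y) ∧ (|y| < 2 → y < 0)) →
      ((0 < x ↔ 0 < y) ↔ (a ↔ b)) := by
    intro x y hxy a b h1 h2 h3 h4
    rw [hxy] at h1 h2
    grind
  have habs : |g e u| = |g e w| := by
    by_cases he : e ∈ N
    · rw [hg.neg e u w hu hw hne he]
    · rw [hg.pos e u w hu hw hne he, abs_neg]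
  rw [← key _ _ habs (P u) (P w) (fun h => h e hu) (fun h => hP u h e hu)
    (fun h => h e hw) (fun h => hP w h e hw)]
  have h0 : g e w ≠ 0 := by
    intro h; rw [habs, h] at h1; norm_num at h1
  by_cases he : e ∈ N
  · simp [he, hg.neg e u w hu hw hne he]
  · simp only [he, false_iff, hg.pos e u w hu hw hne he]
    rcases lt_or_gt_of_ne h0 with h | h
    · intro h'; linarith [h'.1 (by linarith)]
    · intro h'; linarith [h'.2 h]

theorem IsPM.hasFlow_three {M : Finset E} (hM : C.IsPM M) (hN : C.IsCutCompl N) :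
    C.HasFlow N 3 := by
  obtain ⟨S, rfl⟩ := hN
  -- The weights -2, 1, 1 cancel at every vertex. Reversing them outside S makes exactly the cut
  -- edges positive.
  refine ⟨fun e v => (if v ∈ S then 1 else -1) * (if e ∈ M then -2 else 1), ?_, ?_, ?_, ?_, ?_⟩
  · intro e v _
    split_ifs <;> norm_num
  · intro e v _
    split_ifs <;> norm_num
  · intro e u v hu hv huv he
    rw [mem_compl, mem_cut_iff hu hv huv, not_not] at he
    simp [he]
  · intro e u v hu hv huv he
    rw [mem_compl, mem_cut_iff hu hv huv, not_not] at he
    by_cases h1 : u ∈ S <;> by_cases h2 : v ∈ S <;>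
      simp only [h1, h2, if_true, if_false] at he ⊢ <;> grind
  · intro v
    obtain ⟨m, a, b, hm, ha, hb, hma, hmb, hab, hE, -⟩ := hM.edgesAt_eq v
    rw [hE, sum_insert (by simp [hma, hmb]), sum_insert (by simp [hab]), sum_singleton]
    simp only [hm, ha, hb, if_true, if_false]
    ring

/-- Switching at a vertex. -/
theorem HasFlow.switch (h : C.HasFlow N r) (v : V) : C.HasFlow (symmDiff N (C.edgesAt v)) r := by
  obtain ⟨g, hg⟩ := h
  refine ⟨fun e w => if w = v then - g e w else g e w, ?_, ?_, ?_, ?_, ?_⟩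
  · intro e w hw
    have := hg.one_le e w hw
    split_ifs <;> simpa using this
  · intro e w hw
    have := hg.le e w hw
    split_ifs <;> simpa using this
  · intro e a b ha hb hab he
    have h1 := hg.neg e a b ha hb hab
    have h2 := hg.pos e a b ha hb hab
    have h3 : C.inc e v ↔ v = a ∨ v = b := inc_iff_of_inc ha hb hab
    simp only [mem_symmDiff, mem_edgesAt, h3] at he
    grind
  · intro e a b ha hb hab he
    have h1 := hg.neg e a b ha hb hab
    have h2 := hg.pos e a b ha hb hab
    have h3 : C.inc e v ↔ v = a ∨ v = b := inc_iff_of_inc ha hb hab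
    simp only [mem_symmDiff, mem_edgesAt, h3] at he
    grind
  · intro w
    by_cases hw : w = v
    · simp [hw, hg.sum v]
    · simp [hw, hg.sum w]

theorem IsCutCompl.switch (h : C.IsCutCompl N) (v : V) :
    C.IsCutCompl (symmDiff N (C.edgesAt v)) := by
  obtain ⟨S, rfl⟩ := h
  refine ⟨symmDiff S {v}, ?_⟩
  rw [cut_symmDiff, cut_singleton]
  ext e
  simp only [mem_symmDiff, mem_compl]
  tauto

theorem isCutCompl_switch_iff (v : V) :
    C.IsCutCompl (symmDiff N (C.edgesAt v)) ↔ C.IsCutCompl N := by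
  refine ⟨fun h => ?_, fun h => h.switch v⟩
  simpa using h.switch v

/-- Switching at v trades k negative edges there for 3 - k, so a set that does not shrink has k ≤ 1.
-/
theorem card_inter_edgesAt_le_one_of_card_le (v : V)
    (h : N.card ≤ (symmDiff N (C.edgesAt v)).card) : (N ∩ C.edgesAt v).card ≤ 1 := by
  have h1 : (symmDiff N (C.edgesAt v)).card = (N \ C.edgesAt v).card + (C.edgesAt v \ N).card := by
    rw [symmDiff_def]
    exact card_union_of_disjoint disjoint_sdiff_sdiff
  have h2 := card_sdiff_add_card_inter N (C.edgesAt v)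
  have h3 := card_sdiff_add_card_inter (C.edgesAt v) N
  rw [card_edgesAt, inter_comm] at h3
  omega

/-- In the sum of all half-edge values positive edges cancel, while a single negative edge would
contribute twice its nonzero value. -/
theorem HasFlow.card_ne_one (h : C.HasFlow N r) : N.card ≠ 1 := by
  intro h1
  obtain ⟨e₀, rfl⟩ := card_eq_one.1 h1
  obtain ⟨g, hg⟩ := h
  have hs := sum_edgesAt_comm (C := C) univ univ g
  simp only [inter_univ, hg.sum, sum_const_zero] at hs
  have hE : ∀ e, ∑ v ∈ C.ends e, g e v = if e = e₀ then ∑ v ∈ C.ends e₀, g e₀ v else 0 := by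
    intro e
    split_ifs with he
    · rw [he]
    · obtain ⟨v, hv⟩ := exists_inc (C := C) e
      rw [ends_eq_other hv, sum_pair (other_ne e v).symm,
        hg.pos e v _ hv (inc_other e v) (other_ne e v).symm (by simpa using he)]
      ring
  rw [sum_congr rfl (fun e _ => hE e), sum_ite_eq' univ e₀ fun _ => ∑ v ∈ C.ends e₀, g e₀ v,
    if_pos (mem_univ _)] at hs
  obtain ⟨v, hv⟩ := exists_inc (C := C) e₀
  rw [ends_eq_other hv, sum_pair (other_ne e₀ v).symm,
    ← hg.neg e₀ v _ hv (inc_other e₀ v) (other_ne e₀ v).symm (by simp)] at hs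
  have := hg.one_le e₀ v hv
  have h0 : g e₀ v = 0 := by linarith
  rw [h0] at this
  norm_num at this

theorem isClosed_setOf_isHalfEdgeFlow (C : CubicMultigraph V E) (N : Finset E) :
    IsClosed {x : (E → V → ℝ) × ℝ | C.IsHalfEdgeFlow N x.2 x.1} := by
  have : {x : (E → V → ℝ) × ℝ | C.IsHalfEdgeFlow N x.2 x.1} =
      {x | (∀ e v, C.inc e v → 1 ≤ |x.1 e v|) ∧ (∀ e v, C.inc e v → |x.1 e v| ≤ x.2 - 1) ∧
        (∀ e u v, C.inc e u → C.inc e v → u ≠ v → e ∈ N → x.1 e u = x.1 e v) ∧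
        (∀ e u v, C.inc e u → C.inc e v → u ≠ v → e ∉ N → x.1 e u = - x.1 e v) ∧
        ∀ v, ∑ e ∈ C.edgesAt v, x.1 e v = 0} := by
    ext x
    exact ⟨fun h => ⟨h.1, h.2, h.3, h.4, h.5⟩, fun h => ⟨h.1, h.2.1, h.2.2.1, h.2.2.2.1, h.2.2.2.2⟩⟩
  rw [this]
  simp only [Set.ofPred_and, Set.ofPred_forall]
  refine IsClosed.inter ?_ (IsClosed.inter ?_ (IsClosed.inter ?_ (IsClosed.inter ?_ ?_))) <;>
  refine isClosed_iInter fun _ => ?_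
  · exact isClosed_iInter fun _ => isClosed_iInter fun _ =>
      isClosed_le (by fun_prop) (by fun_prop)
  · exact isClosed_iInter fun _ => isClosed_iInter fun _ =>
      isClosed_le (by fun_prop) (by fun_prop)
  · exact isClosed_iInter fun _ => isClosed_iInter fun _ => isClosed_iInter fun _ =>
      isClosed_iInter fun _ => isClosed_iInter fun _ => isClosed_iInter fun _ =>
      isClosed_eq (by fun_prop) (by fun_prop)
  · exact isClosed_iInter fun _ => isClosed_iInter fun _ => isClosed_iInter fun _ =>
      isClosed_iInter fun _ => isClosed_iInter fun _ => isClosed_iInter fun _ =>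
      isClosed_eq (by fun_prop) (by fun_prop)
  · exact isClosed_eq (by fun_prop) (by fun_prop)

/-- The infimum of the `r` with a nowhere-zero `r`-flow is attained. -/
theorem hasFlow_of_forall_lt {r₀ : ℝ} (h : ∀ r, r₀ < r → ∃ r' < r, C.HasFlow N r') :
    C.HasFlow N r₀ := by
  -- For r ≤ r₀ + 1 the flow values have modulus at most r₀. Values off the incidences are
  -- unconstrained and are set to 0 below, so that the box contains the flow.
  let K : Set ((E → V → ℝ) × ℝ) := {x | C.IsHalfEdgeFlow N x.2 x.1} ∩
    (Set.Icc (fun _ _ => - |r₀|) (fun _ _ => |r₀|) ×ˢ Set.Icc r₀ (r₀ + 1))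
  have hK : IsCompact K :=
    (isCompact_Icc.prod isCompact_Icc).inter_left (isClosed_setOf_isHalfEdgeFlow C N)
  have hmem : ∀ r, r₀ < r → r ≤ r₀ + 1 → ∃ g, (g, r) ∈ K := by
    intro r hr hr1
    obtain ⟨r', hr', hf⟩ := h r hr
    obtain ⟨g, hg⟩ := hf.mono hr'.le
    refine ⟨fun e v => if C.inc e v then g e v else 0, ⟨?_, ?_, ?_, ?_, ?_⟩, ⟨?_, ?_⟩, ⟨hr.le, hr1⟩⟩
    · intro e v he; simpa [he] using hg.one_le e v he
    · intro e v he; simpa [he] using hg.le e v he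
    · intro e u v hu hv; simpa [hu, hv] using hg.neg e u v hu hv
    · intro e u v hu hv; simpa [hu, hv] using hg.pos e u v hu hv
    · intro v
      rw [← hg.sum v]
      exact sum_congr rfl fun e he => by simp [mem_edgesAt.1 he]
    · intro e v
      by_cases he : C.inc e v
      · have := (abs_le.1 (hg.le e v he)).1
        simp only [he, if_true]
        linarith [le_abs_self r₀]
      · simp [he]
    · intro e v
      by_cases he : C.inc e v
      · have := (abs_le.1 (hg.le e v he)).2
        simp only [he, if_true]
        linarith [le_abs_self r₀]
      · simp [he]
  obtain ⟨g₁, hg₁⟩ := hmem (r₀ + 1) (by linarith) le_rfl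
  obtain ⟨x, hxK, hx⟩ := hK.exists_isMinOn ⟨_, hg₁⟩ continuous_snd.continuousOn
  refine HasFlow.mono ⟨x.1, hxK.1⟩ ?_
  refine le_of_forall_gt_imp_ge_of_dense fun r hr => ?_
  obtain ⟨g, hg⟩ := hmem (min r (r₀ + 1)) (lt_min hr (by linarith)) (min_le_right _ _)
  exact (hx hg).trans (min_le_left _ _)

end CubicMultigraph

/-! ### From a 4-flow to a 4-edge-colouring -/

namespace CubicMultigraph

open Finset

open scoped Classical

set_option linter.unusedSectionVars false

variable {V E : Type*} {C : CubicMultigraph V E} {e f : E} {u v w : V}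
variable [Fintype V] [Fintype E] {N : Finset E} {r : ℝ}

/-- A nowhere-zero 4-flow can be rounded to integers once each negative edge is cut into two
independent half-edges. -/
theorem HasFlow.exists_int (h : C.HasFlow N 4) :
    ∃ z : E → V → ℤ, (∀ e v, C.inc e v → z e v ≠ 0 ∧ -3 ≤ z e v ∧ z e v ≤ 3) ∧
      (∀ e u v, C.inc e u → C.inc e v → u ≠ v → e ∉ N → z e u = - z e v) ∧
      ∀ v, ∑ e ∈ C.edgesAt v, z e v = 0 := by
  obtain ⟨g, hg⟩ := h
  let x : E × V → ℝ := fun d => if C.inc d.1 d.2 then g d.1 d.2 else 0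
  -- All half-edges of negative edges share the fibre `none`, so rounding keeps the two ends
  -- opposite on positive edges only.
  let q : E × V → Option E := fun d => if d.1 ∈ N then none else some d.1
  -- The bounds [1, 3] and [-3, -1] preserve the sign, so the rounded values are nonzero.
  let l : E × V → ℤ := fun d => if C.inc d.1 d.2 then (if 0 < g d.1 d.2 then 1 else -3) else 0
  let b : E × V → ℤ := fun d => if C.inc d.1 d.2 then (if 0 < g d.1 d.2 then 3 else -1) else 0
  have hbd : ∀ d, (l d : ℝ) ≤ x d ∧ x d ≤ b d := by
    rintro ⟨e, v⟩
    by_cases he : C.inc e v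
    · have h1 := hg.one_le e v he
      have h2 := hg.le e v he
      rcases abs_cases (g e v) with ⟨h3, h4⟩ | ⟨h3, h4⟩
      · have : 0 < g e v := by linarith
        simp only [l, b, x, he, this, if_true]
        push_cast
        constructor <;> linarith
      · have : ¬ 0 < g e v := by linarith
        simp only [l, b, x, he, this, if_true, if_false]
        push_cast
        constructor <;> linarith
    · simp [l, b, x, he]
  have hrow : ∀ v, ∑ e, x (e, v) = 0 := by
    intro v
    rw [← hg.sum v, edgesAt, sum_filter]
  have hcol : ∀ e, e ∉ N → ∑ v, x (e, v) = 0 := by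
    intro e he
    have h1 : ∑ v, x (e, v) = ∑ v ∈ C.ends e, g e v := by rw [ends, sum_filter]
    obtain ⟨v, hv⟩ := exists_inc (C := C) e
    rw [h1, ends_eq_other hv, sum_pair (other_ne e v).symm,
      hg.pos e v _ hv (inc_other e v) (other_ne e v).symm he]
    ring
  -- The fibre `none` also has sum zero: the total vanishes by summing over vertices, and each
  -- positive edge contributes nothing.
  have hcolN : ∑ e ∈ N, ∑ v, x (e, v) = 0 := by
    have h1 : ∑ e, ∑ v, x (e, v) = 0 := by
      rw [sum_comm]
      exact sum_eq_zero fun v _ => hrow v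
    rw [← h1]
    exact sum_subset (subset_univ _) fun e _ he => hcol e he
  obtain ⟨z, hz, hzp, hzq⟩ := exists_int_of_sum_fiber_eq_zero (p := Prod.snd) (q := q) x l b
    (fun d => (hbd d).1) (fun d => (hbd d).2)
    (fun a => by
      rw [sum_filter, Fintype.sum_prod_type]
      refine Eq.trans ?_ (hrow a)
      simp)
    (fun a => by
      rw [sum_filter, Fintype.sum_prod_type]
      rcases a with _ | e
      · rw [← sum_subset (subset_univ N)]
        · refine Eq.trans ?_ hcolN
          refine sum_congr rfl fun e he => sum_congr rfl fun v _ => by simp [q, he]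
        · intro e _ he
          exact sum_eq_zero fun v _ => by simp [q, he]
      · refine sum_eq_zero fun f _ => ?_
        by_cases hf : f ∈ N
        · exact sum_eq_zero fun v _ => by simp [q, hf]
        · by_cases hfe : f = e
          · subst hfe
            refine Eq.trans ?_ (hcol f hf)
            exact sum_congr rfl fun v _ => by simp [q, hf]
          · exact sum_eq_zero fun v _ => by simp [q, hf, hfe])
  have hz0 : ∀ e v, ¬ C.inc e v → z (e, v) = 0 := by
    intro e v he
    have := hz (e, v)
    simp only [l, b, he, if_false] at this
    omega
  refine ⟨fun e v => z (e, v), ?_, ?_, ?_⟩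
  · intro e v he
    have := hz (e, v)
    simp only [l, b, he, if_true] at this ⊢
    split_ifs at this <;> omega
  · intro e u v hu hv huv he
    have h1 := hzq (some e)
    rw [sum_filter, Fintype.sum_prod_type, sum_eq_single e] at h1
    · have h2 : ∑ w, (if q (e, w) = some e then z (e, w) else 0) = ∑ w ∈ C.ends e, z (e, w) := by
        rw [ends, sum_filter]
        refine sum_congr rfl fun w _ => ?_
        by_cases hw : C.inc e w
        · simp [q, he, hw]
        · simp [hw, hz0 e w hw]
      rw [h2, ends_eq hu hv huv, sum_pair huv] at h1
      simp only
      omega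
    · intro f _ hf
      refine sum_eq_zero fun w _ => ?_
      by_cases hfN : f ∈ N <;> simp [q, hfN, hf]
    · simp
  · intro v
    have h1 := hzp v
    rw [sum_filter, Fintype.sum_prod_type] at h1
    rw [← h1, edgesAt, sum_filter]
    refine sum_congr rfl fun e _ => ?_
    by_cases he : C.inc e v
    · simp [he]
    · simp [he, hz0 e v he]

/-- A nowhere-zero 4-flow yields a proper edge colouring in which the negative edges, if they form
a matching, are one of four colour classes. -/
theorem HasFlow.exists_coloring (h : C.HasFlow N 4) (hN : ∀ v, (N ∩ C.edgesAt v).card ≤ 1) :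
    ∃ c : E → Fin 4, (∀ e f v, C.inc e v → C.inc f v → e ≠ f → c e ≠ c f) ∧
      ∀ e, c e = 3 ↔ e ∈ N := by
  obtain ⟨z, hz, hzpos, hzsum⟩ := h.exists_int
  -- two odd half-edges at a vertex determine an even third one
  have hthird : ∀ v e f, C.inc e v → C.inc f v → e ≠ f → ∃ g, C.edgesAt v = {e, f, g} ∧
      C.inc g v ∧ z e v + z f v + z g v = 0 := by
    intro v e f he hf hef
    obtain ⟨g, hge, hgf, hE, hg⟩ := exists_third he hf hef
    refine ⟨g, hE, hg, ?_⟩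
    have := hzsum v
    rw [hE, sum_insert (by simp [hef, hge.symm]), sum_insert (by simp [hgf.symm]),
      sum_singleton] at this
    omega
  -- Odd half-edges are matched along positive edges by R and at vertices by S. The resulting sign
  -- alternates along each path or circuit of odd edges.
  let R : E × V → E × V → Prop := fun d d' =>
    d.1 = d'.1 ∧ d.2 ≠ d'.2 ∧ C.inc d.1 d.2 ∧ C.inc d.1 d'.2 ∧ d.1 ∉ N ∧ Odd (z d.1 d.2)
  let S : E × V → E × V → Prop := fun d d' =>
    d.2 = d'.2 ∧ d.1 ≠ d'.1 ∧ C.inc d.1 d.2 ∧ C.inc d'.1 d.2 ∧ Odd (z d.1 d.2) ∧ Odd (z d'.1 d.2)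
  obtain ⟨s, hsR, hsS⟩ := exists_sign_of_matchings (R := R) (S := S)
    (by
      rintro ⟨e, u⟩ ⟨f, v⟩ ⟨rfl, h2, h3, h4, h5, h6⟩
      refine ⟨rfl, h2.symm, h4, h3, h5, ?_⟩
      rw [hzpos e u v h3 h4 h2 h5, odd_neg] at h6
      exact h6)
    (by
      rintro ⟨e, u⟩ ⟨f, v⟩ ⟨g, w⟩ ⟨rfl, h2, h3, h4, h5, h6⟩ ⟨rfl, h2', h3', h4', h5', h6'⟩
      simp only at *
      have := (inc_iff_of_inc h3 h4 h2).1 h4'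
      grind)
    (by rintro ⟨e, u⟩ ⟨_, h, _⟩; exact h rfl)
    (by
      rintro ⟨e, u⟩ ⟨f, v⟩ ⟨rfl, h2, h3, h4, h5, h6⟩
      exact ⟨rfl, h2.symm, h4, h3, h6, h5⟩)
    (by
      rintro ⟨e, u⟩ ⟨f, v⟩ ⟨g, w⟩ ⟨rfl, h2, h3, h4, h5, h6⟩ ⟨rfl, h2', h3', h4', h5', h6'⟩
      simp only at *
      by_contra hne
      obtain ⟨k, hE, hk, hsum⟩ := hthird u e f h3 h4 h2
      have : g ∈ C.edgesAt u := by simpa using h4'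
      rw [hE] at this
      have hgk : g = k := by simp at this; grind
      subst hgk
      obtain ⟨a, ha⟩ := h5
      obtain ⟨b, hb⟩ := h6
      obtain ⟨c, hc⟩ := h6'
      omega)
    (by rintro ⟨e, u⟩ ⟨_, h, _⟩; exact h rfl)
  have hs1 : ∀ d, (s d : ℤ) = 1 ∨ (s d : ℤ) = -1 := by
    intro d
    rcases Int.units_eq_one_or (s d) with h | h <;> simp [h]
  -- Even values get colour 0; odd ones get colour 1 or 2 according to whether z ≡ s modulo 4. On a
  -- positive edge z and s both change sign, so its two ends agree.
  let κ : E → V → Fin 4 := fun e v =>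
    if Even (z e v) then 0 else if Even ((z e v - s (e, v)) / 2) then 1 else 2
  have hκ : ∀ e u v, C.inc e u → C.inc e v → e ∉ N → κ e u = κ e v := by
    intro e u v hu hv he
    by_cases huv : u = v
    · rw [huv]
    have h1 := hzpos e u v hu hv huv he
    have hodd : Even (z e u) ↔ Even (z e v) := by rw [h1, even_neg]
    by_cases hev : Even (z e u)
    · simp [κ, hev, hodd.1 hev]
    · have hev' : ¬ Even (z e v) := fun h => hev (hodd.2 h)
      have h2 : s (e, v) = - s (e, u) :=
        hsR (e, u) (e, v) ⟨rfl, huv, hu, hv, he, Int.not_even_iff_odd.1 hev⟩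
      have h3 : Even ((z e u - s (e, u)) / 2) ↔ Even ((z e v - s (e, v)) / 2) := by
        rw [h2, Units.val_neg]
        rw [Int.not_even_iff_odd] at hev
        obtain ⟨a, ha⟩ := hev
        rcases hs1 (e, u) with h | h <;> rw [h, Int.even_iff, Int.even_iff] <;> omega
      simp only [κ, hev, hev', if_false, h3]
  have hκne : ∀ e f v, C.inc e v → C.inc f v → e ≠ f → κ e v ≠ κ f v := by
    intro e f v he hf hef
    obtain ⟨g, hE, hg, hsum⟩ := hthird v e f he hf hef
    have h1 := hz e v he
    have h2 := hz f v hf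
    have h3 := hz g v hg
    by_cases hev : Even (z e v) <;> by_cases hfv : Even (z f v)
    -- Two even values would both be ±2, and the third would be 0 or ±4.
    · exfalso
      rw [Int.even_iff] at hev hfv
      omega
    · simp only [κ, hev, hfv, if_true, if_false]
      split_ifs <;> decide
    · simp only [κ, hev, hfv, if_true, if_false]
      split_ifs <;> decide
    -- The third value is even and nonzero, hence ±2. So the two odd values sum to 2 modulo 4 while
    -- their signs cancel, and exactly one of them agrees with its sign modulo 4.
    · have h4 : s (f, v) = - s (e, v) := hsS (e, v) (f, v)
        ⟨rfl, hef, he, hf, Int.not_even_iff_odd.1 hev, Int.not_even_iff_odd.1 hfv⟩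
      have h5 : Even ((z e v - s (e, v)) / 2) ↔ ¬ Even ((z f v - s (f, v)) / 2) := by
        rw [h4, Units.val_neg]
        rw [Int.even_iff] at hev hfv
        rcases hs1 (e, v) with h | h <;> rw [h, Int.even_iff, Int.even_iff] <;> omega
      simp only [κ, hev, hfv, if_false, h5]
      split_ifs <;> decide
  have hκ3 : ∀ e v, κ e v ≠ 3 := by
    intro e v
    simp only [κ]
    split_ifs <;> decide
  choose v₀ hv₀ using exists_inc (C := C)
  refine ⟨fun e => if e ∈ N then 3 else κ e (v₀ e), ?_, ?_⟩
  · intro e f v he hf hef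
    have hκv : ∀ x, C.inc x v → x ∉ N → κ x (v₀ x) = κ x v := fun x hx hxN =>
      hκ x _ _ (hv₀ x) hx hxN
    by_cases heN : e ∈ N <;> by_cases hfN : f ∈ N
    · exact absurd (card_le_one.1 (hN v) e (by simp [heN, he]) f (by simp [hfN, hf])) hef
    · simpa [heN, hfN] using (hκ3 _ _).symm
    · simpa [heN, hfN] using hκ3 _ _
    · simp only [heN, hfN, if_false, hκv e he heN, hκv f hf hfN]
      exact hκne e f v he hf hef
  · intro e
    by_cases heN : e ∈ N
    · simp [heN]
    · simpa [heN] using hκ3 _ _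

end CubicMultigraph

/-! ### 4-flows built on a 1-factor and a matching of its complement -/

namespace CubicMultigraph

open Finset

open scoped Classical

set_option linter.unusedSectionVars false

variable {V E : Type*} {C : CubicMultigraph V E} {e f : E} {u v w : V}
variable [Fintype V] [Fintype E] {M A : Finset E} {t : E → V → ℤˣ}

/-- `t` orients the circuits of the 2-factor `Mᶜ` cyclically. -/
structure IsCyclicOrientation (C : CubicMultigraph V E) (M : Finset E) (t : E → V → ℤˣ) :
    Prop where
  edge : ∀ e u v, e ∉ M → C.inc e u → C.inc e v → u ≠ v → t e v = - t e u
  vertex : ∀ e f v, e ∉ M → f ∉ M → C.inc e v → C.inc f v → e ≠ f → t f v = - t e v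

theorem IsPM.eq_of_mem (hM : C.IsPM M) (he : e ∈ M) (hf : f ∈ M) (hev : C.inc e v)
    (hfv : C.inc f v) : e = f :=
  (hM v).unique ⟨he, hev⟩ ⟨hf, hfv⟩

theorem IsPM.eq_of_notMem (hM : C.IsPM M) {g : E} (he : e ∉ M) (hf : f ∉ M) (hg : g ∉ M)
    (hev : C.inc e v) (hfv : C.inc f v) (hgv : C.inc g v) (hef : e ≠ f) (heg : e ≠ g) : f = g := by
  obtain ⟨m, a, b, hm, ha, hb, -, -, -, -, hinc⟩ := hM.edgesAt_eq v
  rw [hinc] at hev hfv hgv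
  grind

/-- The half-edges of the 2-factor are matched in pairs along edges and in pairs at vertices; the
alternating sign of these two matchings is the orientation. -/
theorem IsPM.exists_isCyclicOrientation (hM : C.IsPM M) : ∃ t, C.IsCyclicOrientation M t := by
  let R : E × V → E × V → Prop := fun d d' =>
    d.1 = d'.1 ∧ d.2 ≠ d'.2 ∧ C.inc d.1 d.2 ∧ C.inc d.1 d'.2 ∧ d.1 ∉ M
  let S : E × V → E × V → Prop := fun d d' =>
    d.2 = d'.2 ∧ d.1 ≠ d'.1 ∧ C.inc d.1 d.2 ∧ C.inc d'.1 d.2 ∧ d.1 ∉ M ∧ d'.1 ∉ M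
  obtain ⟨s, hsR, hsS⟩ := exists_sign_of_matchings (R := R) (S := S)
    (by
      rintro ⟨e, u⟩ ⟨f, v⟩ ⟨rfl, h2, h3, h4, h5⟩
      exact ⟨rfl, h2.symm, h4, h3, h5⟩)
    (by
      rintro ⟨e, u⟩ ⟨f, v⟩ ⟨g, w⟩ ⟨rfl, h2, h3, h4, h5⟩ ⟨rfl, h2', h3', h4', h5'⟩
      simp only at *
      have := (inc_iff_of_inc h3 h4 h2).1 h4'
      grind)
    (by rintro ⟨e, u⟩ ⟨_, h, _⟩; exact h rfl)
    (by
      rintro ⟨e, u⟩ ⟨f, v⟩ ⟨rfl, h2, h3, h4, h5, h6⟩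
      exact ⟨rfl, h2.symm, h4, h3, h6, h5⟩)
    (by
      rintro ⟨e, u⟩ ⟨f, v⟩ ⟨g, w⟩ ⟨rfl, h2, h3, h4, h5, h6⟩ ⟨rfl, h2', h3', h4', h5', h6'⟩
      simp only at *
      rw [hM.eq_of_notMem h5 h6 h6' h3 h4 h4' h2 h2'])
    (by rintro ⟨e, u⟩ ⟨_, h, _⟩; exact h rfl)
  exact ⟨fun e v => s (e, v), fun e u v he hu hv huv => hsR (e, u) (e, v) ⟨rfl, huv, hu, hv, he⟩,
    fun e f v he hf hev hfv hef => hsS (e, v) (f, v) ⟨rfl, hef, hev, hfv, he, hf⟩⟩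

/-- No two edges of `A` share an end. -/
def IsMatching (C : CubicMultigraph V E) (A : Finset E) : Prop :=
  ∀ e f v, e ∈ A → f ∈ A → C.inc e v → C.inc f v → e = f

/-- The vertices not covered by `A`. -/
noncomputable def uncovered (C : CubicMultigraph V E) (A : Finset E) : Finset V :=
  univ.filter fun v => ∀ e ∈ A, ¬ C.inc e v

theorem mem_uncovered : v ∈ C.uncovered A ↔ ∀ e ∈ A, ¬ C.inc e v := by simp [uncovered]

theorem IsPM.isMatching (hM : C.IsPM M) : C.IsMatching M :=
  fun _ _ _ he hf hev hfv => hM.eq_of_mem he hf hev hfv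

theorem exists_sign_of_isMatching {B : Finset E} (hA : C.IsMatching A) (hB : C.IsMatching B) :
    ∃ s : V → ℤˣ, ∀ e u v, e ∈ A ∨ e ∈ B → C.inc e u → C.inc e v → u ≠ v → s v = - s u := by
  have main : ∀ A : Finset E, C.IsMatching A → ∀ x y z : V,
      (x ≠ y ∧ ∃ e ∈ A, C.inc e x ∧ C.inc e y) → (x ≠ z ∧ ∃ e ∈ A, C.inc e x ∧ C.inc e z) →
      y = z := by
    rintro A hA x y z ⟨hxy, e, he, hex, hey⟩ ⟨hxz, f, hf, hfx, hfz⟩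
    obtain rfl := hA e f x he hf hex hfx
    have := (inc_iff_of_inc hex hey hxy).1 hfz
    grind
  have symm : ∀ A : Finset E, ∀ x y : V,
      (x ≠ y ∧ ∃ e ∈ A, C.inc e x ∧ C.inc e y) → (y ≠ x ∧ ∃ e ∈ A, C.inc e y ∧ C.inc e x) := by
    rintro A x y ⟨hxy, e, he, hex, hey⟩
    exact ⟨hxy.symm, e, he, hey, hex⟩
  obtain ⟨s, hs1, hs2⟩ := exists_sign_of_matchings (symm A) (main A hA) (by simp)
    (symm B) (main B hB) (by simp)
  refine ⟨s, fun e u v he hu hv huv => ?_⟩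
  rcases he with he | he
  · exact hs1 u v ⟨huv, e, he, hu, hv⟩
  · exact hs2 u v ⟨huv, e, he, hu, hv⟩

/-- The edges selected at the vertices not covered by `A`. -/
noncomputable def selected (C : CubicMultigraph V E) (M A : Finset E) (t : E → V → ℤˣ)
    (s : V → ℤˣ) : Finset E :=
  univ.filter fun e => e ∉ M ∧ ∃ w ∈ C.uncovered A, C.inc e w ∧ t e w = s w

theorem mem_selected {s : V → ℤˣ} :
    e ∈ C.selected M A t s ↔ e ∉ M ∧ ∃ w ∈ C.uncovered A, C.inc e w ∧ t e w = s w := by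
  simp [selected]

/-- A 4-flow whose negative edges are selected at the vertices missed by a matching of the
2-factor `Mᶜ`. -/
theorem IsPM.hasFlow_four {s : V → ℤˣ} (hM : C.IsPM M) (ht : C.IsCyclicOrientation M t)
    (hAM : Disjoint A M) (hA : C.IsMatching A)
    (hs : ∀ e u v, e ∈ M ∨ e ∈ A → C.inc e u → C.inc e v → u ≠ v → s v = - s u)
    (hunc : ∀ e u v, e ∉ M → C.inc e u → C.inc e v → u ≠ v → u ∈ C.uncovered A →
      v ∉ C.uncovered A) :
    C.HasFlow (C.selected M A t s) 4 := by
  have hAM' : ∀ e ∈ A, e ∉ M := fun e he hm => disjoint_left.1 hAM he hm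
  -- The circular flow t is modified by 2s on M and -2s on A, which balance at vertices covered by
  -- A. At an uncovered vertex the circuit half-edge with t = s takes the -2s alone and turns into
  -- -t, which makes its edge negative.
  let g : E → V → ℤ := fun e v =>
    if e ∈ M then 2 * s v
    else if e ∈ A ∨ (v ∈ C.uncovered A ∧ t e v = s v) then t e v - 2 * s v else t e v
  have hu : ∀ x : ℤˣ, (x : ℤ) = 1 ∨ (x : ℤ) = -1 := by
    intro x
    rcases Int.units_eq_one_or x with h | h <;> simp [h]
  have hne : ∀ x y : ℤˣ, x ≠ y → (x : ℤ) = - y := by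
    intro x y h
    rcases Int.units_eq_one_or x with h1 | h1 <;> rcases Int.units_eq_one_or y with h2 | h2 <;>
      simp_all
  have hAunc : ∀ e ∈ A, ∀ v, C.inc e v → v ∉ C.uncovered A :=
    fun e he v hv h => mem_uncovered.1 h e he hv
  have hbd : ∀ e v, 1 ≤ |g e v| ∧ |g e v| ≤ 3 := by
    intro e v
    simp only [g]
    split_ifs <;> rcases hu (s v) with h1 | h1 <;> rcases hu (t e v) with h2 | h2 <;>
      simp only [h1, h2] <;> decide
  refine ⟨fun e v => g e v, ?_, ?_, ?_, ?_, ?_⟩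
  · intro e v _
    exact_mod_cast (hbd e v).1
  · intro e v _
    have : |((g e v : ℤ) : ℝ)| ≤ 3 := by exact_mod_cast (hbd e v).2
    linarith
  · intro e u v heu hev huv he
    have key : ∀ u v, C.inc e u → C.inc e v → u ≠ v → e ∉ M → u ∈ C.uncovered A → t e u = s u →
        g e u = g e v := by
      intro u v hu hv huv heM huA hus
      have heA : e ∉ A := fun h => hAunc e h u hu huA
      have h1 := ht.edge e u v heM hu hv huv
      have hvA := hunc e u v heM hu hv huv huA
      simp only [g, heM, heA, huA, hvA, hus, h1, if_false, false_or, and_self, if_true, false_and,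
        Units.val_neg]
      omega
    obtain ⟨heM, w, hwA, hew, hw⟩ := mem_selected.1 he
    rcases (inc_iff_of_inc heu hev huv).1 hew with rfl | rfl
    · exact_mod_cast key w v heu hev huv heM hwA hw
    · exact_mod_cast (key w u hev heu huv.symm heM hwA hw).symm
  · intro e u v heu hev huv he
    have hsp : e ∉ M → ∀ w, C.inc e w → ¬ (w ∈ C.uncovered A ∧ t e w = s w) := fun heM w hw h =>
      he (mem_selected.2 ⟨heM, w, h.1, hw, h.2⟩)
    have : g e u = - g e v := by
      by_cases heM : e ∈ M
      · have := hs e u v (Or.inl heM) heu hev huv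
        simp [g, heM, this]
      · have h1 := ht.edge e u v heM heu hev huv
        by_cases heA : e ∈ A
        · have := hs e u v (Or.inr heA) heu hev huv
          simp only [g, heM, heA, this, h1, if_false, true_or, if_true, Units.val_neg]
          ring
        · simp only [g, heM, heA, hsp heM u heu, hsp heM v hev, if_false, or_false]
          rw [h1, Units.val_neg, neg_neg]
    exact_mod_cast this
  · intro v
    obtain ⟨m, a, b, hm, ha, hb, hma, hmb, hab, hE, hinc⟩ := hM.edgesAt_eq v
    rw [hE, sum_insert (by simp [hma, hmb]), sum_insert (by simp [hab]), sum_singleton]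
    have hav := (hinc a).2 (by simp)
    have hbv := (hinc b).2 (by simp)
    have htab := ht.vertex a b v ha hb hav hbv hab
    have : g m v + (g a v + g b v) = 0 := by
      by_cases hv : v ∈ C.uncovered A
      · have haA : a ∉ A := fun h => hAunc a h v hav hv
        have hbA : b ∉ A := fun h => hAunc b h v hbv hv
        by_cases hta : t a v = s v
        · have htb : t b v ≠ s v := by
            rw [htab, hta]
            rcases Int.units_eq_one_or (s v) with h | h <;> simp [h]
          simp only [g, hm, ha, hb, haA, hbA, hv, hta, htb, if_true, if_false, false_or, true_and]
          rw [htab, hta, Units.val_neg]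
          ring
        · have htb : t b v = s v := by
            apply Units.ext
            rw [htab, Units.val_neg, hne _ _ hta, neg_neg]
          have hta' := hne _ _ hta
          simp only [g, hm, ha, hb, haA, hbA, hv, hta, htb, if_true, if_false, false_or, true_and,
            hta']
          ring
      · have hex : ∃ e ∈ A, C.inc e v := by
          by_contra! h
          exact hv (mem_uncovered.2 h)
        obtain ⟨e, heA, hev⟩ := hex
        have hor : (a ∈ A ∧ b ∉ A) ∨ (a ∉ A ∧ b ∈ A) := by
          rcases (hinc e).1 hev with rfl | rfl | rfl
          · exact absurd hm (hAM' _ heA)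
          · exact Or.inl ⟨heA, fun h => hab (hA _ _ v heA h hav hbv)⟩
          · exact Or.inr ⟨fun h => hab (hA _ _ v h heA hav hbv), heA⟩
        rcases hor with ⟨h1, h2⟩ | ⟨h1, h2⟩ <;>
        · simp only [g, hm, ha, hb, h1, h2, hv, if_true, if_false, false_or, false_and, true_or,
            htab, Units.val_neg]
          ring
    exact_mod_cast this

/-- The two circuit edges at a vertex carry opposite values of t, so each uncovered vertex selects
only one of them. -/
theorem IsCyclicOrientation.card_selected_le {s : V → ℤˣ} (ht : C.IsCyclicOrientation M t) :
    (C.selected M A t s).card ≤ (C.uncovered A).card := by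
  have h : ∀ e ∈ C.selected M A t s, ∃ w ∈ C.uncovered A, e ∉ M ∧ C.inc e w ∧ t e w = s w := by
    intro e he
    obtain ⟨h1, w, h2, h3, h4⟩ := mem_selected.1 he
    exact ⟨w, h2, h1, h3, h4⟩
  rcases isEmpty_or_nonempty V with hV | hV
  · rw [card_eq_zero.2]
    · simp
    · refine eq_empty_of_forall_notMem fun e he => ?_
      obtain ⟨w, -⟩ := h e he
      exact hV.elim w
  choose! φ hφ using h
  refine card_le_card_of_injOn φ (fun e he => (hφ e he).1) ?_
  intro e he f hf hef
  obtain ⟨-, h1, h2, h3⟩ := hφ e he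
  obtain ⟨-, h4, h5, h6⟩ := hφ f hf
  by_contra hne
  rw [← hef] at h5 h6
  have := ht.vertex e f _ h1 h4 h2 h5 hne
  rw [h6, h3] at this
  rcases Int.units_eq_one_or (s (φ e)) with h | h <;> simp [h] at this

end CubicMultigraph

/-! ### Matchings of the circuits of a 2-factor -/

namespace CubicMultigraph

open Finset

open scoped Classical

set_option linter.unusedSectionVars false

variable {V E : Type*} {C : CubicMultigraph V E} {e f : E} {u v w : V}
variable [Fintype V] [Fintype E] {M A : Finset E} {t : E → V → ℤˣ}

/-- The spanning simple graph of adjacency through edges in `F`. -/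
def factorGraph (C : CubicMultigraph V E) (F : Finset E) : SimpleGraph V where
  Adj u v := u ≠ v ∧ ∃ e ∈ F, C.inc e u ∧ C.inc e v
  symm := ⟨fun _ _ ⟨h, e, he, hu, hv⟩ => ⟨h.symm, e, he, hv, hu⟩⟩
  loopless := ⟨fun _ h => h.1 rfl⟩

/-- The successor permutation of a cyclic orientation. -/
theorem IsCyclicOrientation.exists_perm (hM : C.IsPM M) (ht : C.IsCyclicOrientation M t) :
    ∃ (π : Equiv.Perm V) (out : V → E), (∀ v, out v ∉ M) ∧
      (∀ v w, C.inc (out v) w ↔ w = v ∨ w = π v) ∧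
      ∀ e v, e ∉ M → C.inc e v → e = out v ∨ e = out (π.symm v) := by
  have hout : ∀ v, ∃ e, e ∉ M ∧ C.inc e v ∧ t e v = 1 := by
    intro v
    obtain ⟨m, a, b, hm, ha, hb, hma, hmb, hab, hE, hinc⟩ := hM.edgesAt_eq v
    have hav := (hinc a).2 (by simp)
    have hbv := (hinc b).2 (by simp)
    rcases Int.units_eq_one_or (t a v) with h | h
    · exact ⟨a, ha, hav, h⟩
    · exact ⟨b, hb, hbv, by rw [ht.vertex a b v ha hb hav hbv hab, h, neg_neg]⟩
  choose out hout1 hout2 hout3 using hout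
  have huniq : ∀ e f v, e ∉ M → f ∉ M → C.inc e v → C.inc f v → t e v = t f v → e = f := by
    intro e f v he hf hev hfv htt
    by_contra hne
    have := ht.vertex e f v he hf hev hfv hne
    rw [← htt] at this
    rcases Int.units_eq_one_or (t e v) with h | h <;> simp [h] at this
  have htin : ∀ v, t (out v) (C.other (out v) v) = -1 := fun v => by
    rw [ht.edge _ _ _ (hout1 v) (hout2 v) (inc_other _ v) (other_ne _ v).symm, hout3]
  have hinj : Function.Injective fun v => C.other (out v) v := by
    intro u v huv
    simp only at huv
    have h1 := htin u
    have h2 := htin v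
    have h3 := inc_other (C := C) (out u) u
    rw [huv] at h1 h3
    have h4 := huniq _ _ _ (hout1 u) (hout1 v) h3 (inc_other _ _) (h1.trans h2.symm)
    rw [← other_other (hout2 u), huv, h4, other_other (hout2 v)]
  let π : Equiv.Perm V := Equiv.ofBijective _ (Finite.injective_iff_bijective.1 hinj)
  refine ⟨π, out, hout1, fun v w => inc_iff_other (hout2 v), ?_⟩
  intro e v he hev
  rcases Int.units_eq_one_or (t e v) with h | h
  · exact Or.inl (huniq e _ v he (hout1 v) hev (hout2 v) (h.trans (hout3 v).symm))
  · right
    have h1 : t e (C.other e v) = 1 := by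
      rw [ht.edge e v _ he hev (inc_other e v) (other_ne e v).symm, h, neg_neg]
    have h2 : e = out (C.other e v) :=
      huniq e _ _ he (hout1 _) (inc_other e v) (hout2 _) (h1.trans (hout3 _).symm)
    have h3 : π (C.other e v) = v := by
      change C.other (out (C.other e v)) (C.other e v) = v
      rw [← h2, other_other hev]
    have h4 : π.symm v = C.other e v := by rw [Equiv.symm_apply_eq, h3]
    rw [h4]
    exact h2

/-- One representative per cycle. On the cycle of x it is the predecessor of x, since the vertex
left uncovered will be the successor of the representative. -/
theorem exists_root (π : Equiv.Perm V) (x : V) : ∃ root : V → V,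
    (∀ v, π.SameCycle v (root v)) ∧ (∀ u v, π.SameCycle u v → root u = root v) ∧
      π (root x) = x := by
  let st := Equiv.Perm.SameCycle.setoid π
  refine ⟨fun v => if π.SameCycle x v then π.symm x else (Quotient.mk st v).out, ?_, ?_, ?_⟩
  · intro v
    beta_reduce
    split_ifs with h
    · refine h.symm.trans ⟨-1, ?_⟩
      simp [Equiv.Perm.inv_def]
    · exact Equiv.Perm.SameCycle.symm (Quotient.mk_out (s := st) v)
  · intro u v huv
    have h1 : π.SameCycle x u ↔ π.SameCycle x v :=
      ⟨fun h => h.trans huv, fun h => h.trans huv.symm⟩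
    have h2 : Quotient.mk st u = Quotient.mk st v := Quotient.sound huv
    simp only [h1, h2]
  · simp [Equiv.Perm.SameCycle.refl]

/-- A 2-factor has a matching that misses at most one vertex of each circuit, and this vertex can
be prescribed on one circuit. -/
theorem IsCyclicOrientation.exists_isMatching (hM : C.IsPM M) (ht : C.IsCyclicOrientation M t)
    (x : V) : ∃ A : Finset E, Disjoint A M ∧ C.IsMatching A ∧
      (∀ w ∈ C.uncovered A, ∀ w' ∈ C.uncovered A, (C.factorGraph Mᶜ).Reachable w w' → w = w') ∧
      ∀ w ∈ C.uncovered A, (C.factorGraph Mᶜ).Reachable w x → w = x := by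
  obtain ⟨π, out, hout, hinc, hout'⟩ := ht.exists_perm hM
  obtain ⟨root, hr1, hr2, hr3⟩ := exists_root π x
  have hex : ∀ v, ∃ j : ℕ, (π ^ j) v = root v := fun v => by
    obtain ⟨j, -, hj⟩ := (hr1 v).exists_pow_eq'
    exact ⟨j, hj⟩
  -- The number of steps from v to the root of its circuit. Taking the outgoing edges at odd j
  -- covers every vertex except possibly the successor of the root: any other even vertex has an odd
  -- predecessor.
  let j : V → ℕ := fun v => Nat.find (hex v)
  have hrπ : ∀ v, root (π v) = root v := fun v => hr2 _ _ (Equiv.Perm.SameCycle.symm ⟨1, by simp⟩)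
  have hj : ∀ v, v ≠ root v → j (π v) + 1 = j v := by
    intro v hv
    have hpos : j v ≠ 0 := by
      intro h
      have := Nat.find_spec (hex v)
      rw [show Nat.find (hex v) = 0 from h] at this
      exact hv (by simpa using this)
    apply le_antisymm
    · have h1 : j (π v) ≤ j v - 1 := by
        refine Nat.find_min' _ ?_
        rw [hrπ, ← Nat.find_spec (hex v)]
        conv_rhs => rw [show Nat.find (hex v) = (j v - 1) + 1 by change j v = _; omega, pow_succ]
        rfl
      omega
    · refine Nat.find_min' _ ?_
      rw [pow_succ]
      exact (Nat.find_spec (hex (π v))).trans (hrπ v)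
  have hodd : ∀ v, Odd (j v) → ¬ Odd (j (π v)) := by
    intro v hv h
    have hne : v ≠ root v := by
      intro hr
      have : j v = 0 := (Nat.find_eq_zero (hex v)).2 (by simpa using hr)
      rw [this] at hv
      exact absurd hv (by decide)
    have := hj v hne
    rw [← this] at hv
    exact absurd hv (by simpa [Nat.odd_add_one] using h)
  let A : Finset E := (univ.filter fun v => Odd (j v)).image out
  have hA : ∀ e, e ∈ A ↔ ∃ v, Odd (j v) ∧ out v = e := by intro e; simp [A]
  have hroot : ∀ w ∈ C.uncovered A, w = π (root w) := by
    intro w hw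
    rw [mem_uncovered] at hw
    have h1 : ¬ Odd (j w) := fun h => hw _ ((hA _).2 ⟨w, h, rfl⟩) ((hinc _ _).2 (Or.inl rfl))
    obtain ⟨u, rfl⟩ := π.surjective w
    have h2 : ¬ Odd (j u) := fun h => hw _ ((hA _).2 ⟨u, h, rfl⟩) ((hinc _ _).2 (Or.inr rfl))
    by_contra hne
    have h3 : u ≠ root u := by
      intro h
      rw [hrπ, ← h] at hne
      exact hne rfl
    have := hj u h3
    rw [← this, Nat.odd_add_one] at h2
    exact h2 h1
  have hreach : ∀ a b, (C.factorGraph Mᶜ).Reachable a b → π.SameCycle a b := by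
    rintro a b ⟨p⟩
    induction p with
    | nil => exact Equiv.Perm.SameCycle.refl _ _
    | cons h _ ih =>
      refine Equiv.Perm.SameCycle.trans ?_ ih
      obtain ⟨hne, e, he, hea, heb⟩ := h
      rw [mem_compl] at he
      rcases hout' e _ he hea with rfl | rfl
      · rcases (hinc _ _).1 heb with h | h
        · exact absurd h.symm hne
        · exact ⟨1, by simp [h]⟩
      · rcases (hinc _ _).1 heb with h | h
        · exact ⟨-1, by rw [h]; simp [Equiv.Perm.inv_def]⟩
        · rw [Equiv.apply_symm_apply] at h
          exact absurd h.symm hne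
  refine ⟨A, ?_, ?_, ?_, ?_⟩
  · rw [disjoint_left]
    intro e he
    obtain ⟨v, -, rfl⟩ := (hA e).1 he
    exact hout v
  · intro e f v he hf hev hfv
    obtain ⟨a, ha, rfl⟩ := (hA e).1 he
    obtain ⟨b, hb, rfl⟩ := (hA f).1 hf
    rcases (hinc _ _).1 hev with rfl | rfl <;> rcases (hinc _ _).1 hfv with h | h
    · rw [h]
    · rw [h] at ha
      exact absurd ha (hodd b hb)
    · rw [← h] at hb
      exact absurd hb (hodd a ha)
    · rw [π.injective h]
  · intro w hw w' hw' h
    rw [hroot w hw, hroot w' hw', hr2 _ _ (hreach _ _ h)]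
  · intro w hw h
    rw [hroot w hw, hr2 _ _ (hreach _ _ h), hr3]

theorem mem_supp_of_inc {F : Finset E} {c : (C.factorGraph F).ConnectedComponent} (he : e ∈ F)
    (hu : C.inc e u) (hv : C.inc e v) (huc : u ∈ c.supp) : v ∈ c.supp := by
  by_cases huv : u = v
  · rwa [← huv]
  · exact SimpleGraph.ConnectedComponent.mem_supp_of_adj_mem_supp c huc ⟨huv, e, he, hu, hv⟩

/-- The parity of a circuit is the parity of the number of its vertices missed by a matching. -/
theorem odd_ncard_supp_iff (hAM : Disjoint A M) (hA : C.IsMatching A)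
    (c : (C.factorGraph Mᶜ).ConnectedComponent) :
    Odd c.supp.ncard ↔ Odd (C.uncovered A ∩ c.supp.toFinset).card := by
  let K := c.supp.toFinset
  have h := sum_card_edgesAt_inter (C := C) K A
  have h0 : C.cut K ∩ A = ∅ := by
    refine eq_empty_of_forall_notMem fun e he => ?_
    obtain ⟨h1, h2⟩ := mem_inter.1 he
    obtain ⟨u, v, hu, hv, huK, hvK⟩ := mem_cut.1 h1
    refine hvK ?_
    simp only [K, Set.mem_toFinset] at huK ⊢
    exact mem_supp_of_inc (by simpa using disjoint_left.1 hAM h2) hu hv huK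
  have h1 : ∀ v ∈ K, (C.edgesAt v ∩ A).card = if v ∈ C.uncovered A then 0 else 1 := by
    intro v _
    split_ifs with hv
    · rw [card_eq_zero]
      refine eq_empty_of_forall_notMem fun e he => ?_
      simp only [mem_inter, mem_edgesAt] at he
      exact mem_uncovered.1 hv e he.2 he.1
    · have hex : ∃ e ∈ A, C.inc e v := by
        by_contra! h
        exact hv (mem_uncovered.2 h)
      obtain ⟨e, he, hev⟩ := hex
      refine card_eq_one.2 ⟨e, ?_⟩
      ext f
      simp only [mem_inter, mem_edgesAt, mem_singleton]
      exact ⟨fun hf => hA f e v hf.2 he hf.1 hev, fun hf => hf ▸ ⟨hev, he⟩⟩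
  rw [sum_congr rfl h1, h0, card_empty, zero_add, sum_ite, sum_const_zero, zero_add, sum_const,
    smul_eq_mul, mul_one] at h
  have h2 : (K.filter (· ∈ C.uncovered A)).card + (K.filter (· ∉ C.uncovered A)).card = K.card :=
    card_filter_add_card_filter_not _
  rw [h, filter_mem_eq_inter, inter_comm] at h2
  rw [Set.ncard_eq_toFinset_card', ← h2, Nat.odd_add]
  simp [K]

/-- Uncovered vertices lie on distinct circuits, and a circuit with exactly one of them is odd. -/
theorem card_uncovered_le (hAM : Disjoint A M) (hA : C.IsMatching A)
    (hu : ∀ w ∈ C.uncovered A, ∀ w' ∈ C.uncovered A, (C.factorGraph Mᶜ).Reachable w w' → w = w') :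
    (C.uncovered A).card ≤ (C.factorGraph Mᶜ).oddComponents.ncard := by
  rw [Set.ncard_eq_toFinset_card']
  refine card_le_card_of_injOn (fun w => (C.factorGraph Mᶜ).connectedComponentMk w) ?_ ?_
  · intro w hw
    simp only [mem_coe, Set.mem_toFinset]
    refine (odd_ncard_supp_iff hAM hA _).2 ?_
    rw [card_eq_one.2 ⟨w, ?_⟩]
    · exact odd_one
    · ext w'
      simp only [mem_inter, Set.mem_toFinset, SimpleGraph.ConnectedComponent.mem_supp_iff,
        SimpleGraph.ConnectedComponent.eq, mem_singleton]
      refine ⟨fun h => hu _ h.1 _ hw h.2, ?_⟩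
      rintro rfl
      exact ⟨hw, SimpleGraph.Reachable.refl _⟩
  · intro w hw w' hw' h
    exact hu w hw w' hw' (SimpleGraph.ConnectedComponent.exact h)

/-- The prescribed vertex of an odd circuit is missed. -/
theorem mem_uncovered_of_odd (hAM : Disjoint A M) (hA : C.IsMatching A) {x : V}
    (hx : ∀ w ∈ C.uncovered A, (C.factorGraph Mᶜ).Reachable w x → w = x)
    (hodd : Odd ((C.factorGraph Mᶜ).connectedComponentMk x).supp.ncard) : x ∈ C.uncovered A := by
  rw [odd_ncard_supp_iff hAM hA] at hodd
  obtain ⟨w, hw⟩ := card_pos.1 hodd.pos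
  simp only [mem_inter, Set.mem_toFinset, SimpleGraph.ConnectedComponent.mem_supp_iff,
    SimpleGraph.ConnectedComponent.eq] at hw
  rw [← hx w hw.1 hw.2]
  exact hw.1

end CubicMultigraph

/-! ### Bounds for cut complements, and 1-factors through a given edge -/

namespace CubicMultigraph

open Finset

open scoped Classical

set_option linter.unusedSectionVars false

variable {V E : Type*} {C : CubicMultigraph V E} {e f : E} {u v w : V}
variable [Fintype V] [Fintype E] {M N : Finset E}

/-- By the handshake identity on both sides, the numbers of edges inside S and inside its complement
differ by a multiple of 3, so they cannot be 1 and 0. -/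
theorem IsCutCompl.card_ne_one (h : C.IsCutCompl N) : N.card ≠ 1 := by
  obtain ⟨S, rfl⟩ := h
  have h1 := three_mul_card (C := C) S
  have h2 := three_mul_card (C := C) Sᶜ
  rw [cut_compl] at h2
  rw [card_compl_cut]
  omega

/-- The cut of an independent set has 3|S| of the 3|V|/2 edges. -/
theorem exists_isCutCompl_of_isIndepSet {S : Finset V}
    (hS : (C.factorGraph univ).IsIndepSet (S : Set V)) :
    ∃ N, C.IsCutCompl N ∧ 2 * N.card + 6 * S.card = 3 * Fintype.card V := by
  refine ⟨_, ⟨S, rfl⟩, ?_⟩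
  have h1 := three_mul_card (C := C) S
  have h2 : C.inside S = ∅ := by
    refine eq_empty_of_forall_notMem fun e he => ?_
    obtain ⟨v, hv⟩ := exists_inc (C := C) e
    rw [mem_inside_iff_other hv] at he
    have hne := (other_ne (C := C) e v).symm
    exact hS he.1 he.2 hne ⟨hne, e, mem_univ _, hv, inc_other e v⟩
  have h3 := three_mul_card_univ C
  have h4 := card_add_card_compl (C.cut S)
  rw [h2, card_empty] at h1
  omega

theorem two_mul_card_le_of_matching (h : ∀ v, (N ∩ C.edgesAt v).card ≤ 1) :
    2 * N.card ≤ Fintype.card V := by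
  have h0 := sum_card_edgesAt_inter (C := C) univ N
  have h1 : C.cut univ = ∅ := by ext; simp [mem_cut]
  have h2 : C.inside univ = univ := by ext; simp [mem_inside]
  rw [h1, h2, empty_inter, univ_inter, card_empty, zero_add] at h0
  rw [← h0]
  refine (sum_le_card_nsmul univ _ 1 fun v _ => ?_).trans (by simp)
  rw [inter_comm]
  exact h v

theorem IsPM.card_edgesAt_inter_compl (hM : C.IsPM M) (v : V) : (C.edgesAt v ∩ Mᶜ).card = 2 := by
  obtain ⟨m, a, b, hm, ha, hb, hma, hmb, hab, hE, hinc⟩ := hM.edgesAt_eq v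
  refine card_eq_two.2 ⟨a, b, hab, ?_⟩
  ext x
  simp only [hE, mem_inter, mem_insert, mem_singleton, mem_compl]
  grind

/-- Every odd circuit of a 2-factor contains an edge outside any given cut. -/
theorem IsCutCompl.exists_mem_of_odd (hM : C.IsPM M) (hN : C.IsCutCompl N)
    {c : (C.factorGraph Mᶜ).ConnectedComponent} (hc : Odd c.supp.ncard) :
    ∃ e ∈ N \ M, ∀ v, C.inc e v → v ∈ c.supp := by
  obtain ⟨S, rfl⟩ := hN
  by_contra! hcon
  let K := c.supp.toFinset
  have hK : ∀ {v}, v ∈ K ↔ v ∈ c.supp := by simp [K]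
  -- If no edge of the circuit avoids the cut, every edge joins the two sides. Counting circuit
  -- edges from either side gives 2|K ∩ S| = 2|K \ S|, so the circuit is even.
  have key : ∀ T : Finset V, (∀ u v, u ∈ T → v ∈ T → (u ∈ S ↔ v ∈ S)) → T ⊆ K →
      2 * T.card = (C.cut T ∩ Mᶜ).card := by
    intro T hT hTK
    have h1 := sum_card_edgesAt_inter (C := C) T Mᶜ
    have h2 : C.inside T ∩ Mᶜ = ∅ := by
      refine eq_empty_of_forall_notMem fun e he => ?_
      obtain ⟨h3, h4⟩ := mem_inter.1 he
      rw [mem_compl] at h4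
      rw [mem_inside] at h3
      obtain ⟨v, hv⟩ := exists_inc (C := C) e
      obtain ⟨w, hw, hwc⟩ := hcon e (by
        rw [mem_sdiff, mem_compl, mem_cut_iff_other hv, not_not]
        exact ⟨hT _ _ (h3 v hv) (h3 _ (inc_other e v)), h4⟩)
      exact hwc (hK.1 (hTK (h3 w hw)))
    rw [sum_congr rfl fun v _ => hM.card_edgesAt_inter_compl v, h2] at h1
    simpa [mul_comm] using h1
  have h1 := key (K ∩ S) (by simp +contextual) inter_subset_left
  have h2 := key (K \ S) (by simp +contextual) sdiff_subset
  have h3 : C.cut (K ∩ S) ∩ Mᶜ = C.cut (K \ S) ∩ Mᶜ := by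
    ext e
    simp only [mem_inter, mem_compl, and_congr_left_iff]
    intro he
    obtain ⟨v, hv⟩ := exists_inc (C := C) e
    have ho := inc_other (C := C) e v
    have h4 : v ∈ K ↔ C.other e v ∈ K := by
      rw [hK, hK]
      exact ⟨mem_supp_of_inc (by simpa using he) hv ho, mem_supp_of_inc (by simpa using he) ho hv⟩
    rw [mem_cut_iff_other hv, mem_cut_iff_other hv]
    simp only [mem_inter, mem_sdiff]
    tauto
  rw [h3] at h1
  have h4 := card_sdiff_add_card_inter K S
  rw [Set.ncard_eq_toFinset_card', ← h4] at hc
  obtain ⟨k, hk⟩ := hc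
  omega

theorem IsCutCompl.ncard_oddComponents_le (hM : C.IsPM M) (hN : C.IsCutCompl N) :
    (C.factorGraph Mᶜ).oddComponents.ncard ≤ (N \ M).card := by
  rcases isEmpty_or_nonempty E with hE | hE
  · have : (C.factorGraph Mᶜ).oddComponents = ∅ := by
      refine Set.eq_empty_of_forall_notMem fun c hc => ?_
      obtain ⟨e, -⟩ := hN.exists_mem_of_odd hM hc
      exact hE.elim e
    simp [this]
  have h : ∀ c ∈ (C.factorGraph Mᶜ).oddComponents, ∃ e ∈ N \ M, ∀ v, C.inc e v → v ∈ c.supp :=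
    fun c hc => hN.exists_mem_of_odd hM hc
  choose! φ hφ hφ' using h
  rw [← Set.ncard_coe_finset]
  refine Set.ncard_le_ncard_of_injOn φ (fun c hc => hφ c hc) ?_ (Set.toFinite _)
  intro c hc c' hc' hcc
  obtain ⟨v, hv⟩ := exists_inc (C := C) (φ c)
  have h1 := hφ' c hc v hv
  have h2 := hφ' c' hc' v (hcc ▸ hv)
  rw [SimpleGraph.ConnectedComponent.mem_supp_iff] at h1 h2
  exact h1.symm.trans h2

theorem three_le_card_cut (hbr : ∀ S, (C.cut S).card ≠ 1) {S : Finset V} (hS : Odd S.card) :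
    3 ≤ (C.cut S).card := by
  have h1 := three_mul_card (C := C) S
  have h2 := hbr S
  obtain ⟨k, hk⟩ := hS
  omega

/-- In a bridgeless cubic graph, deleting the ends of an edge leaves a graph with a perfect
matching. -/
theorem exists_isPerfectMatching_comap (hbr : ∀ S, (C.cut S).card ≠ 1) (hu : C.inc e u)
    (hv : C.inc e v) (huv : u ≠ v) :
    ∃ P : ((C.factorGraph univ).comap (Subtype.val : {x // x ≠ u ∧ x ≠ v} → V)).Subgraph,
      P.IsPerfectMatching := by
  rw [SimpleGraph.tutte]
  intro T hT
  unfold SimpleGraph.IsTutteViolator at hT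
  set H := (C.factorGraph univ).comap (Subtype.val : {x // x ≠ u ∧ x ≠ v} → V) with hH
  set Q := (⊤ : H.Subgraph).deleteVerts T with hQ
  have hQv : ∀ y : {x // x ≠ u ∧ x ≠ v}, y ∈ Q.verts ↔ y ∉ T := by simp [hQ]
  -- As |V| is even, the number of odd components has the parity of |T|, so a Tutte violator has at
  -- least |T| + 2 of them.
  have hcardV : Fintype.card V = Nat.card {x // x ≠ u ∧ x ≠ v} + 2 := by
    have h1 : (univ.filter fun x : V => x ≠ u ∧ x ≠ v) = ({u, v} : Finset V)ᶜ := by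
      ext x; simp
    rw [Nat.card_eq_fintype_card, Fintype.card_subtype, h1, ← card_pair huv, add_comm,
      card_add_card_compl]
  have hparity : Odd Q.coe.oddComponents.ncard ↔ Odd T.ncard := by
    rw [SimpleGraph.odd_ncard_oddComponents]
    have h1 : Nat.card Q.verts = Tᶜ.ncard := by
      rw [Nat.card_coe_set_eq]
      congr 1
      ext y; simp [hQv]
    have h2 := Set.ncard_add_ncard_compl T
    have h3 := three_mul_card_univ C
    rw [h1, Nat.odd_iff, Nat.odd_iff]
    omega
  let K : Q.coe.ConnectedComponent → Finset V := fun c =>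
    univ.filter fun x => ∃ y ∈ c.supp, y.1.1 = x
  let S : Finset V := (T.toFinset.image Subtype.val) ∪ {u, v}
  have hS : S.card = T.ncard + 2 := by
    rw [card_union_of_disjoint, card_image_of_injective _ Subtype.val_injective, card_pair huv,
      Set.ncard_eq_toFinset_card']
    rw [disjoint_left]
    intro x hx
    obtain ⟨y, -, rfl⟩ := mem_image.1 hx
    simpa using y.2
  have hSmem : ∀ y : {x // x ≠ u ∧ x ≠ v}, y.1 ∈ S ↔ y ∈ T := by
    intro y
    have := y.2
    simp [S, y.2.1, y.2.2]
  have hKcard : ∀ c, (K c).card = c.supp.ncard := by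
    intro c
    rw [← Set.ncard_coe_finset, ← Set.ncard_image_of_injective c.supp
      (f := fun y : Q.verts => y.1.1) (Subtype.val_injective.comp Subtype.val_injective)]
    congr 1
    ext x; simp [K]
  have hKS : ∀ c, ∀ x ∈ K c, x ∉ S := by
    intro c x hx
    obtain ⟨y, -, rfl⟩ := (mem_filter.1 hx).2
    rw [hSmem]
    exact (hQv _).1 y.2
  have hcut : ∀ c f a b, C.inc f a → C.inc f b → a ∈ K c → b ∉ K c → b ∈ S := by
    intro c f a b hfa hfb ha hb
    by_contra hbS
    obtain ⟨y, hy, rfl⟩ := (mem_filter.1 ha).2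
    have hb2 : b ≠ u ∧ b ≠ v := by
      constructor <;> rintro rfl <;> exact hbS (by simp [S])
    have hbT : (⟨b, hb2⟩ : {x // x ≠ u ∧ x ≠ v}) ∉ T := fun h => hbS ((hSmem _).2 h)
    refine hb (mem_filter.2 ⟨mem_univ _, ⟨⟨b, hb2⟩, (hQv _).2 hbT⟩, ?_, rfl⟩)
    refine SimpleGraph.ConnectedComponent.mem_supp_of_adj_mem_supp c hy ?_
    have hne : y.1.1 ≠ b := by rintro rfl; exact hb ha
    have hadj : H.Adj y.1 ⟨b, hb2⟩ := ⟨hne, f, mem_univ _, hfa, hfb⟩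
    simp only [SimpleGraph.Subgraph.coe_adj, hQ, SimpleGraph.Subgraph.deleteVerts_adj,
      SimpleGraph.Subgraph.verts_top, Set.mem_univ, true_and, SimpleGraph.Subgraph.top_adj]
    exact ⟨(hQv _).1 y.2, hbT, hadj⟩
  have hdisj : ∀ c c' x, x ∈ K c → x ∈ K c' → c = c' := by
    intro c c' x hx hx'
    obtain ⟨y, hy, rfl⟩ := (mem_filter.1 hx).2
    obtain ⟨y', hy', hyy⟩ := (mem_filter.1 hx').2
    obtain rfl : y' = y := Subtype.val_injective (Subtype.val_injective hyy)
    rw [SimpleGraph.ConnectedComponent.mem_supp_iff] at hy hy'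
    exact hy.symm.trans hy'
  -- Edges leaving a component end in S, so the cuts of different components are disjoint subsets of
  -- the cut of S. Each odd component contributes at least three edges.
  have hsum : ∑ c ∈ Q.coe.oddComponents.toFinset, (C.cut (K c)).card ≤ (C.cut S).card := by
    rw [← card_biUnion]
    · refine card_le_card ?_
      intro f hf
      obtain ⟨c, -, hfc⟩ := mem_biUnion.1 hf
      obtain ⟨a, b, hfa, hfb, ha, hb⟩ := mem_cut.1 hfc
      exact mem_cut.2 ⟨b, a, hfb, hfa, hcut c f a b hfa hfb ha hb, hKS c a ha⟩
    · intro c _ c' _ hcc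
      rw [Function.onFun, disjoint_left]
      intro f hf hf'
      obtain ⟨a, b, hfa, hfb, ha, hb⟩ := mem_cut.1 hf
      obtain ⟨a', b', hfa', hfb', ha', hb'⟩ := mem_cut.1 hf'
      have hab : a ≠ b := by rintro rfl; exact hb ha
      rcases (inc_iff_of_inc hfa hfb hab).1 hfa' with rfl | rfl
      · exact hcc (hdisj c c' _ ha ha')
      · exact hKS c' _ ha' (hcut c f a _ hfa hfb ha hb)
  have hle : 3 * Q.coe.oddComponents.ncard ≤ (C.cut S).card := by
    refine le_trans ?_ hsum
    rw [Set.ncard_eq_toFinset_card', mul_comm, ← smul_eq_mul]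
    refine card_nsmul_le_sum _ _ 3 fun c hc => ?_
    refine three_le_card_cut hbr ?_
    rw [hKcard]
    simpa using hc
  -- The edge e lies inside S, which leaves at most 3(|T| + 2) - 2 cut edges, fewer than the odd
  -- components require.
  have h1 := three_mul_card (C := C) S
  have h2 : 0 < (C.inside S).card := by
    refine card_pos.2 ⟨e, ?_⟩
    rw [mem_inside]
    intro w hw
    rcases (inc_iff_of_inc hu hv huv).1 hw with rfl | rfl <;> simp [S]
  rw [Nat.odd_iff, Nat.odd_iff] at hparity
  omega

/-- In a bridgeless cubic graph every edge lies in a perfect matching. -/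
theorem exists_isPM_mem (hbr : ∀ S, (C.cut S).card ≠ 1) (e : E) : ∃ M, C.IsPM M ∧ e ∈ M := by
  obtain ⟨u, v, huv, hends⟩ := C.exists_ends e
  have hu := (hends u).2 (by simp)
  have hv := (hends v).2 (by simp)
  obtain ⟨P, hP, hPs⟩ := exists_isPerfectMatching_comap hbr hu hv huv
  -- The Tutte matching lives in a simple graph; one edge is fixed per pair of adjacent vertices,
  -- with e as a dummy for the other pairs.
  have hch : ∀ p : Finset V, ∃ f, (∃ f', C.ends f' = p) → C.ends f = p := by
    intro p
    by_cases h : ∃ f', C.ends f' = p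
    · exact ⟨h.choose, fun _ => h.choose_spec⟩
    · exact ⟨e, fun h' => absurd h' h⟩
  choose ch hch using hch
  have hPch : ∀ y z, P.Adj y z → C.ends (ch {y.1, z.1}) = {y.1, z.1} := by
    intro y z hyz
    obtain ⟨hne, f, -, hfy, hfz⟩ := P.adj_sub hyz
    exact hch _ ⟨f, ends_eq hfy hfz hne⟩
  have hPinc : ∀ y z, P.Adj y z → ∀ x, C.inc (ch {y.1, z.1}) x ↔ x = y.1 ∨ x = z.1 := by
    intro y z hyz x
    rw [← mem_ends, hPch y z hyz]
    simp
  refine ⟨insert e (univ.filter fun f => ∃ y z, P.Adj y z ∧ f = ch {y.1, z.1}), ?_, by simp⟩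
  intro x
  by_cases hx : x ≠ u ∧ x ≠ v
  · obtain ⟨z, hz, hzu⟩ := hP (hPs ⟨x, hx⟩)
    refine ⟨ch {x, z.1}, ⟨?_, (hPinc _ _ hz x).2 (Or.inl rfl)⟩, ?_⟩
    · simp only [mem_insert, mem_filter, mem_univ, true_and]
      exact Or.inr ⟨_, _, hz, rfl⟩
    · rintro f ⟨hf, hfx⟩
      simp only [mem_insert, mem_filter, mem_univ, true_and] at hf
      rcases hf with rfl | ⟨a, b, hab, rfl⟩
      · rw [hends] at hfx
        tauto
      · rcases (hPinc a b hab x).1 hfx with h | h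
        · have ha : a = ⟨x, hx⟩ := Subtype.ext h.symm
          subst ha
          rw [hzu b hab]
        · have hb : b = ⟨x, hx⟩ := Subtype.ext h.symm
          subst hb
          rw [hzu a hab.symm, pair_comm]
  · have hex : C.inc e x := by
      rw [hends]
      tauto
    refine ⟨e, ⟨by simp, hex⟩, ?_⟩
    rintro f ⟨hf, hfx⟩
    simp only [mem_insert, mem_filter, mem_univ, true_and] at hf
    rcases hf with rfl | ⟨a, b, hab, rfl⟩
    · rfl
    · rcases (hPinc a b hab x).1 hfx with rfl | rfl
      · exact absurd a.2 hx
      · exact absurd b.2 hx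

end CubicMultigraph

/-! ### Signatures with flow number exactly four -/

namespace CubicMultigraph

open Finset

open scoped Classical

set_option linter.unusedSectionVars false

variable {V E : Type*} {C : CubicMultigraph V E} {e f : E} {u v w : V}
variable [Fintype V] [Fintype E] {M N : Finset E}

/-- Every colour of a proper 3-edge-colouring of a cubic graph is a perfect matching. -/
theorem isPM_of_coloring {c : E → Fin 3}
    (hc : ∀ e f v, C.inc e v → C.inc f v → e ≠ f → c e ≠ c f) (i : Fin 3) :
    C.IsPM (univ.filter fun e => c e = i) := by
  intro v
  have hinj : Set.InjOn c (C.edgesAt v) := by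
    intro e he f hf hef
    by_contra hne
    exact hc e f v (by simpa using he) (by simpa using hf) hne hef
  have himg : (C.edgesAt v).image c = univ := by
    rw [← card_eq_iff_eq_univ, card_image_of_injOn hinj, card_edgesAt, Fintype.card_fin]
  have hi : i ∈ (C.edgesAt v).image c := by rw [himg]; exact mem_univ _
  obtain ⟨e, he, hei⟩ := mem_image.1 hi
  refine ⟨e, ⟨by simpa using hei, by simpa using he⟩, ?_⟩
  rintro f ⟨hf, hfv⟩
  rw [mem_filter] at hf
  exact hinj (by simpa using hfv) he (hf.2.trans hei.symm)

/-- One colour serves as the 1-factor and a second as the matching of its complement; no vertex is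
uncovered, so no edge becomes negative. -/
theorem hasFlow_empty_of_coloring {c : E → Fin 3}
    (hc : ∀ e f v, C.inc e v → C.inc f v → e ≠ f → c e ≠ c f) : C.HasFlow ∅ 4 := by
  have hM := isPM_of_coloring hc 0
  have hA := isPM_of_coloring hc 1
  obtain ⟨t, ht⟩ := hM.exists_isCyclicOrientation
  obtain ⟨s, hs⟩ := exists_sign_of_isMatching hM.isMatching hA.isMatching
  have hunc : C.uncovered (univ.filter fun e => c e = 1) = ∅ := by
    refine eq_empty_of_forall_notMem fun v hv => ?_
    obtain ⟨e, ⟨he, hev⟩, -⟩ := hA v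
    exact mem_uncovered.1 hv e he hev
  have h := hM.hasFlow_four ht (s := s) (A := univ.filter fun e => c e = 1) (by
      rw [disjoint_left]
      intro e he he'
      simp only [mem_filter, mem_univ, true_and] at he he'
      rw [he] at he'
      exact absurd he' (by decide)) hA.isMatching hs (by simp [hunc])
  have hsel : C.selected (univ.filter fun e => c e = 0) (univ.filter fun e => c e = 1) t s = ∅ := by
    refine eq_empty_of_forall_notMem fun e he => ?_
    obtain ⟨-, w, hw, -⟩ := mem_selected.1 he
    simp [hunc] at hw
  rwa [hsel] at h

theorem isCutCompl_empty_iff : C.IsCutCompl ∅ ↔ ∃ S, C.cut S = univ := by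
  constructor
  · rintro ⟨S, hS⟩
    exact ⟨S, by simpa using hS.symm⟩
  · rintro ⟨S, hS⟩
    exact ⟨S, by simp [hS]⟩

theorem isCutCompl_empty_iff_isBipartite :
    C.IsCutCompl ∅ ↔ (C.factorGraph univ).IsBipartite := by
  rw [isCutCompl_empty_iff]
  constructor
  · rintro ⟨S, hS⟩
    refine ⟨SimpleGraph.Coloring.mk (fun v => if v ∈ S then 0 else 1) ?_⟩
    rintro u v ⟨hne, e, -, hu, hv⟩
    have : e ∈ C.cut S := by rw [hS]; exact mem_univ _
    rw [mem_cut_iff hu hv hne] at this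
    by_cases h1 : u ∈ S <;> by_cases h2 : v ∈ S <;> simp_all
  · rintro ⟨c⟩
    refine ⟨univ.filter fun v => c v = 0, ?_⟩
    ext e
    obtain ⟨v, hv⟩ := exists_inc (C := C) e
    have hne := (other_ne (C := C) e v).symm
    have := c.valid (v := v) (w := C.other e v) ⟨hne, e, mem_univ _, hv, inc_other e v⟩
    rw [mem_cut_iff_other hv]
    simp only [mem_filter, mem_univ, true_and, iff_true]
    omega

/-- The symmetric difference of two complements of cuts is a cut. -/
theorem IsCutCompl.exists_cut_eq_symmDiff {N' : Finset E} (h : C.IsCutCompl N)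
    (h' : C.IsCutCompl N') : ∃ S, C.cut S = symmDiff N N' := by
  obtain ⟨S, rfl⟩ := h
  obtain ⟨S', rfl⟩ := h'
  refine ⟨symmDiff S S', ?_⟩
  rw [cut_symmDiff]
  ext e
  simp only [mem_symmDiff, mem_compl]
  tauto

/-- Bipartite cubic graphs are bridgeless. -/
theorem card_cut_ne_one_of_isCutCompl_empty (h : C.IsCutCompl ∅) (S : Finset V) :
    (C.cut S).card ≠ 1 := by
  obtain ⟨T, hT⟩ := isCutCompl_empty_iff.1 h
  refine IsCutCompl.card_ne_one (C := C) ⟨symmDiff S T, ?_⟩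
  rw [cut_symmDiff, hT]
  ext e
  simp

/-- On every odd circuit of a 2-factor, either the selected edge can be changed so as to leave the
class of cut complements, or the matching edges at its vertices are bridges. -/
theorem IsPM.exists_cut_eq_of_forall_isCutCompl (hM : C.IsPM M) {x : V}
    (hx : Odd ((C.factorGraph Mᶜ).connectedComponentMk x).supp.ncard)
    (h : ∀ X, C.HasFlow X 4 → X.card ≤ (C.factorGraph Mᶜ).oddComponents.ncard → C.IsCutCompl X) :
    ∃ S, C.cut S = C.edgesAt x ∩ M := by
  obtain ⟨t, ht⟩ := hM.exists_isCyclicOrientation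
  obtain ⟨A, hAM, hA, hu, hux⟩ := ht.exists_isMatching hM x
  obtain ⟨s, hs⟩ := exists_sign_of_isMatching hM.isMatching hA
  have hxu := mem_uncovered_of_odd hAM hA hux hx
  -- Reversing t on the circuit of x alone exchanges the selected edge at x for the other circuit
  -- edge there and leaves the other selections unchanged.
  let κ : V → ℤˣ := fun v => if (C.factorGraph Mᶜ).Reachable v x then -1 else 1
  have hκ : ∀ e u v, e ∉ M → C.inc e u → C.inc e v → u ≠ v → κ u = κ v := by
    intro e u v he heu hev huv
    have hadj : (C.factorGraph Mᶜ).Adj u v := ⟨huv, e, by simpa using he, heu, hev⟩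
    have : (C.factorGraph Mᶜ).Reachable u x ↔ (C.factorGraph Mᶜ).Reachable v x :=
      ⟨fun h => hadj.symm.reachable.trans h, fun h => hadj.reachable.trans h⟩
    simp only [κ, this]
  have ht' : C.IsCyclicOrientation M fun e v => κ v * t e v := by
    refine ⟨fun e u v he heu hev huv => ?_, fun e f v he hf hev hfv hef => ?_⟩
    · rw [ht.edge e u v he heu hev huv, hκ e u v he heu hev huv, mul_neg]
    · rw [ht.vertex e f v he hf hev hfv hef, mul_neg]
  have hunc : ∀ e u v, e ∉ M → C.inc e u → C.inc e v → u ≠ v → u ∈ C.uncovered A →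
      v ∉ C.uncovered A := by
    intro e u v he heu hev huv hu1 hv1
    refine huv (hu u hu1 v hv1 (SimpleGraph.Adj.reachable ⟨huv, e, by simpa using he, heu, hev⟩))
  have hle := card_uncovered_le hAM hA hu
  have h1 := h _ (hM.hasFlow_four ht hAM hA hs hunc) (ht.card_selected_le.trans hle)
  have h2 := h _ (hM.hasFlow_four ht' hAM hA hs hunc) (ht'.card_selected_le.trans hle)
  obtain ⟨S, hS⟩ := h1.exists_cut_eq_symmDiff h2
  have hκx : κ x = -1 := by simp [κ]
  have hκw : ∀ w ∈ C.uncovered A, w ≠ x → κ w = 1 := by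
    intro w hw hwx
    simp only [κ]
    rw [if_neg fun hr => hwx (hux w hw hr)]
  have hdiff : symmDiff (C.selected M A t s) (C.selected M A (fun e v => κ v * t e v) s) =
      C.edgesAt x \ M := by
    ext e
    rw [mem_symmDiff, mem_selected, mem_selected, mem_sdiff, mem_edgesAt]
    by_cases he : e ∈ M
    · simp [he]
    simp only [he, not_false_eq_true, true_and, and_true]
    by_cases hex : C.inc e x
    · have huniq : ∀ w ∈ C.uncovered A, C.inc e w → w = x := by
        intro w hw hew
        by_contra hne
        exact hunc e x w he hex hew (Ne.symm hne) hxu hw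
      have e1 : ∀ Q : V → Prop, (∃ w ∈ C.uncovered A, C.inc e w ∧ Q w) ↔ Q x := by
        intro Q
        constructor
        · rintro ⟨w, hw, hew, hQ⟩
          rwa [← huniq w hw hew]
        · exact fun hQ => ⟨x, hxu, hex, hQ⟩
      rw [e1 fun w => t e w = s w, e1 fun w => κ w * t e w = s w, hκx]
      rcases Int.units_eq_one_or (t e x) with h1 | h1 <;>
        rcases Int.units_eq_one_or (s x) with h2 | h2 <;> simp [h1, h2, hex]
    · have e2 : (∃ w ∈ C.uncovered A, C.inc e w ∧ κ w * t e w = s w) ↔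
          ∃ w ∈ C.uncovered A, C.inc e w ∧ t e w = s w := by
        refine exists_congr fun w => and_congr_right fun hw => and_congr_right fun hew => ?_
        rw [hκw w hw (by rintro rfl; exact hex hew), one_mul]
      simp [e2, hex]
  -- Moving x across the cut replaces its two circuit edges by the 1-factor edge at x.
  refine ⟨symmDiff S {x}, ?_⟩
  rw [cut_symmDiff, hS, hdiff, cut_singleton]
  ext e
  simp only [mem_symmDiff, mem_sdiff, mem_inter]
  tauto

/-- A signature with a 4-flow and at most as many negative edges as `Mᶜ` has odd circuits. -/
theorem IsPM.exists_hasFlow_four [Nonempty V] (hM : C.IsPM M) :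
    ∃ X, C.HasFlow X 4 ∧ X.card ≤ (C.factorGraph Mᶜ).oddComponents.ncard := by
  obtain ⟨t, ht⟩ := hM.exists_isCyclicOrientation
  obtain ⟨A, hAM, hA, hu, -⟩ := ht.exists_isMatching hM (Classical.arbitrary V)
  obtain ⟨s, hs⟩ := exists_sign_of_isMatching hM.isMatching hA
  refine ⟨_, hM.hasFlow_four ht hAM hA hs fun e u v he heu hev huv hu1 hv1 => ?_,
    ht.card_selected_le.trans (card_uncovered_le hAM hA hu)⟩
  exact huv (hu u hu1 v hv1 (SimpleGraph.Adj.reachable ⟨huv, e, by simpa using he, heu, hev⟩))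

/-- A vertex set whose cut is a single edge contains an odd circuit of every 2-factor. -/
theorem IsPM.exists_odd_component_subset (hM : C.IsPM M) {S : Finset V} (hS : (C.cut S).card = 1) :
    C.cut S ⊆ M ∧ ∃ c : (C.factorGraph Mᶜ).ConnectedComponent, Odd c.supp.ncard ∧
      ∀ v ∈ c.supp, v ∈ S := by
  have h1 := three_mul_card (C := C) S
  have hodd : Odd S.card := by rw [Nat.odd_iff]; omega
  -- Since |S| is odd, the 1-factor must leave S, and the cut has only one edge.
  have hSM : C.cut S ⊆ M := by
    have h2 := sum_card_edgesAt_inter (C := C) S M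
    have h3 : ∀ v, (C.edgesAt v ∩ M).card = 1 := by
      intro v
      have h4 := hM.card_edgesAt_inter_compl v
      have h5 := card_sdiff_add_card_inter (C.edgesAt v) M
      rw [card_edgesAt, sdiff_eq_inter_compl, h4] at h5
      omega
    rw [sum_congr rfl fun v _ => h3 v, sum_const, smul_eq_mul, mul_one] at h2
    have h4 : (C.cut S ∩ M).card ≠ 0 := by
      intro h
      rw [Nat.odd_iff] at hodd
      omega
    have h5 : (C.cut S).card ≤ (C.cut S ∩ M).card := by omega
    exact (eq_of_subset_of_card_le inter_subset_left h5) ▸ inter_subset_right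
  refine ⟨hSM, ?_⟩
  have h2 := card_eq_sum_card_fiberwise (s := S) (t := univ)
    (f := (C.factorGraph Mᶜ).connectedComponentMk) (by simp)
  -- No edge of the 2-factor leaves S, so S is a union of circuits; one of them is odd because |S|
  -- is.
  have h3 : ∃ c, Odd (S.filter fun v => (C.factorGraph Mᶜ).connectedComponentMk v = c).card := by
    by_contra! h
    rw [h2, ← Nat.not_even_iff_odd] at hodd
    exact hodd (even_sum _ fun c _ => Nat.not_odd_iff_even.1 (h c))
  obtain ⟨c, hc⟩ := h3
  have hsub : ∀ v ∈ c.supp, v ∈ S := by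
    obtain ⟨u, hu⟩ := card_pos.1 hc.pos
    obtain ⟨huS, huc⟩ := mem_filter.1 hu
    intro v hv
    have hr : (C.factorGraph Mᶜ).Reachable u v := by
      rw [SimpleGraph.ConnectedComponent.mem_supp_iff] at hv
      exact SimpleGraph.ConnectedComponent.exact (huc.trans hv.symm)
    obtain ⟨p⟩ := hr
    clear hu huc hv
    induction p with
    | nil => exact huS
    | cons h _ ih =>
      refine ih ?_
      obtain ⟨hne, e, he, hea, heb⟩ := h
      by_contra hb
      have : e ∈ C.cut S := mem_cut.2 ⟨_, _, hea, heb, huS, hb⟩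
      exact (mem_compl.1 he) (hSM this)
  refine ⟨c, ?_, hsub⟩
  rw [Set.ncard_eq_toFinset_card']
  convert hc using 2
  ext v
  simp only [Set.mem_toFinset, SimpleGraph.ConnectedComponent.mem_supp_iff, mem_filter]
  exact ⟨fun h => ⟨hsub v h, h⟩, fun h => h.2⟩

/-- If `Mᶜ` has an odd circuit, some signature with at most as many negative edges as there are odd
circuits has a 4-flow but is not switching equivalent to the all-negative one. -/
theorem IsPM.exists_hasFlow_four_not_isCutCompl (hM : C.IsPM M)
    (hne : (C.factorGraph Mᶜ).oddComponents.Nonempty) :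
    ∃ X, C.HasFlow X 4 ∧ ¬ C.IsCutCompl X ∧
      X.card ≤ (C.factorGraph Mᶜ).oddComponents.ncard := by
  by_contra! hcon
  have hcut : ∀ x, Odd ((C.factorGraph Mᶜ).connectedComponentMk x).supp.ncard →
      ∃ S, C.cut S = C.edgesAt x ∩ M := fun x hx =>
    hM.exists_cut_eq_of_forall_isCutCompl hx fun X hX hle => by
      by_contra h
      exact absurd hle (not_le.2 (hcon X hX h))
  have hcut1 : ∀ x, ∃ m ∈ M, C.inc m x ∧ C.edgesAt x ∩ M = {m} := by
    intro x
    obtain ⟨m, ⟨hm, hmx⟩, huniq⟩ := hM x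
    refine ⟨m, hm, hmx, ?_⟩
    ext f
    simp only [mem_inter, mem_edgesAt, mem_singleton]
    exact ⟨fun h => huniq f ⟨h.2, h.1⟩, fun h => h ▸ ⟨hmx, hm⟩⟩
  have hexS : ∃ S, (C.cut S).card = 1 := by
    obtain ⟨c, hc⟩ := hne
    obtain ⟨x, rfl⟩ := c.exists_rep
    obtain ⟨S, hS⟩ := hcut x hc
    obtain ⟨m, -, -, h⟩ := hcut1 x
    exact ⟨S, by rw [hS, h, card_singleton]⟩
  -- A smallest side of a bridge contains an odd circuit. The 1-factor edge at a vertex of this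
  -- circuit off the bridge is a further bridge, which cuts off a smaller side.
  obtain ⟨S, hS, hmin⟩ := exists_min_image (univ.filter fun S => (C.cut S).card = 1) card
    (by obtain ⟨S, hS⟩ := hexS; exact ⟨S, by simpa using hS⟩)
  have hS : (C.cut S).card = 1 := by simpa using hS
  obtain ⟨hSM, c, hc, hcS⟩ := hM.exists_odd_component_subset hS
  obtain ⟨m, hm⟩ := card_eq_one.1 hS
  obtain ⟨p, q, hmp, hmq, hpS, hqS⟩ := mem_cut.1 (hm ▸ mem_singleton_self m : m ∈ C.cut S)
  have hpq : p ≠ q := by rintro rfl; exact hqS hpS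
  -- a vertex of the odd circuit that is not an end of the bridge
  have hx : ∃ x ∈ c.supp, x ≠ p := by
    obtain ⟨y, rfl⟩ := c.exists_rep
    by_cases hy : y = p
    · obtain ⟨_, a, _, _, ha, -, -, -, -, -, hinc⟩ := hM.edgesAt_eq y
      have hay := (hinc a).2 (by simp)
      refine ⟨C.other a y, ?_, by rw [← hy]; exact other_ne a y⟩
      exact mem_supp_of_inc (by simpa using ha) hay (inc_other a y) rfl
    · exact ⟨y, rfl, hy⟩
  obtain ⟨x, hxc, hxp⟩ := hx
  have hxS := hcS x hxc
  have hmx : ¬ C.inc m x := by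
    intro h
    rcases (inc_iff_of_inc hmp hmq hpq).1 h with h | h
    · exact hxp h
    · exact hqS (h ▸ hxS)
  obtain ⟨T, hT⟩ := hcut x (by
    rw [SimpleGraph.ConnectedComponent.mem_supp_iff] at hxc
    rwa [hxc])
  obtain ⟨m', -, hm'x, hm'⟩ := hcut1 x
  rw [hm'] at hT
  have hmm' : m ≠ m' := by rintro rfl; exact hmx hm'x
  -- U is the side of the second bridge that avoids the end p, and hence also q. Thus the first
  -- bridge does not leave S ∩ U, and p witnesses that S ∩ U is smaller than S.
  obtain ⟨U, hU, hpU⟩ : ∃ U, C.cut U = {m'} ∧ p ∉ U := by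
    by_cases hp : p ∈ T
    · exact ⟨Tᶜ, by rw [cut_compl, hT], by simpa using hp⟩
    · exact ⟨T, hT, hp⟩
  have hqU : q ∉ U := by
    have : m ∉ C.cut U := by rw [hU]; simpa using hmm'
    rw [mem_cut_iff hmp hmq hpq] at this
    tauto
  have hR : C.cut (S ∩ U) = {m'} := by
    ext f
    have hfS : f ∈ C.cut S ↔ f = m := by rw [hm]; simp
    have hfU : f ∈ C.cut U ↔ f = m' := by rw [hU]; simp
    rw [mem_singleton]
    by_cases hfm : f = m
    · subst hfm
      rw [mem_cut_iff hmp hmq hpq]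
      simp [hpU, hqU, hmm']
    by_cases hfm' : f = m'
    · subst hfm'
      rw [mem_cut_iff_other hm'x] at hfS hfU ⊢
      simp only [mem_inter]
      tauto
    · obtain ⟨v, hv⟩ := exists_inc (C := C) f
      rw [mem_cut_iff_other hv] at hfS hfU ⊢
      simp only [mem_inter]
      tauto
  have h1 := hmin (S ∩ U) (by simp [hR])
  have h2 : (S ∩ U).card < S.card := by
    refine card_lt_card ⟨inter_subset_left, fun h => hpU ?_⟩
    exact (mem_inter.1 (h hpS)).2
  omega

/-- A 4-flow on a bipartite cubic graph with two negative edges at distance one. -/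
theorem IsPM.hasFlow_four_pair {a : E} (hM : C.IsPM M) (h0 : C.IsCutCompl ∅) (he : e ∉ M)
    (ha : a ∉ M) (hf : f ∉ M) (hev : C.inc e v) (hav : C.inc a v) (haw : C.inc a w)
    (hfw : C.inc f w) (hvw : v ≠ w) (hea : e ≠ a) (haf : a ≠ f) (hef : e ≠ f) :
    C.HasFlow {e, f} 4 := by
  obtain ⟨S, hS⟩ := isCutCompl_empty_iff.1 h0
  -- The default weights are -2, 1, 1. At v and w they become -2, 3, -1, with 3 on the common edge
  -- a. Multiplied by the sign of the bipartition class, an edge is negative exactly when its two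
  -- weights are opposite, which happens for e and f.
  let b : E → V → ℝ := fun x y =>
    if x ∈ M then -2 else if x = a then 3
      else if (x = e ∧ y = v) ∨ (x = f ∧ y = w) then -1 else 1
  have hew : ¬ C.inc e w := fun h => hef (hM.eq_of_notMem ha he hf haw h hfw hea.symm haf)
  have hfv : ¬ C.inc f v := fun h => hef (hM.eq_of_notMem ha he hf hav hev h hea.symm haf)
  have hcut : ∀ x u' v', C.inc x u' → C.inc x v' → u' ≠ v' → ¬ (u' ∈ S ↔ v' ∈ S) := by
    intro x u' v' hu' hv' hne
    rw [← mem_cut_iff hu' hv' hne, hS]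
    exact mem_univ _
  have habs : ∀ x y, |(if y ∈ S then 1 else -1) * b x y| = |b x y| := by
    intro x y
    split_ifs <;> simp
  refine ⟨fun x y => (if y ∈ S then 1 else -1) * b x y, ?_, ?_, ?_, ?_, ?_⟩
  · intro x y _
    rw [habs]
    simp only [b]
    split_ifs <;> norm_num
  · intro x y _
    rw [habs]
    simp only [b]
    split_ifs <;> norm_num
  · intro x u' v' hu' hv' hne hx
    have h1 := hcut x u' v' hu' hv' hne
    have h2 : b x u' = - b x v' := by
      rcases mem_insert.1 hx with rfl | hx
      · have h3 := (inc_iff_of_inc hu' hv' hne).1 hev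
        simp only [b, he, hea, hef, if_false, false_and, or_false, true_and]
        rcases h3 with rfl | rfl
        · simp [hne.symm]
        · simp [hne]
      · obtain rfl := mem_singleton.1 hx
        have h3 := (inc_iff_of_inc hu' hv' hne).1 hfw
        simp only [b, hf, haf.symm, hef.symm, if_false, false_and, false_or, true_and]
        rcases h3 with rfl | rfl
        · simp [hne.symm]
        · simp [hne]
    rw [h2]
    by_cases h3 : u' ∈ S <;> by_cases h4 : v' ∈ S <;> simp_all
  · intro x u' v' hu' hv' hne hx
    have h1 := hcut x u' v' hu' hv' hne
    simp only [mem_insert, mem_singleton, not_or] at hx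
    have h2 : b x u' = b x v' := by simp [b, hx]
    rw [h2]
    by_cases h3 : u' ∈ S <;> by_cases h4 : v' ∈ S <;> simp_all
  · intro y
    rw [← mul_sum]
    refine mul_eq_zero_of_right _ ?_
    by_cases hyv : y = v
    · subst hyv
      obtain ⟨m, hme, hma, hE, hmy⟩ := exists_third hev hav hea
      have hm : m ∈ M := by
        by_contra h
        exact hma.symm (hM.eq_of_notMem he ha h hev hav hmy hea hme.symm)
      rw [hE, sum_insert (by simp [hea, hme.symm]), sum_insert (by simp [hma.symm]), sum_singleton]
      simp only [b, hm, he, ha, hea, if_true, if_false, and_self, true_or]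
      norm_num
    by_cases hyw : y = w
    · subst hyw
      obtain ⟨m, hmf, hma, hE, hmy⟩ := exists_third hfw haw haf.symm
      have hm : m ∈ M := by
        by_contra h
        exact hma.symm (hM.eq_of_notMem hf ha h hfw haw hmy haf.symm hmf.symm)
      rw [hE, sum_insert (by simp [haf.symm, hmf.symm]), sum_insert (by simp [hma.symm]),
        sum_singleton]
      simp only [b, hm, hf, ha, haf.symm, if_true, if_false, and_self, or_true]
      norm_num
    · obtain ⟨m, c, d, hm, hc, hd, hmc, hmd, hcd, hE, hinc⟩ := hM.edgesAt_eq y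
      have hay : ¬ C.inc a y := fun h => by
        rcases (inc_iff_of_inc hav haw hvw).1 h with h | h
        · exact hyv h
        · exact hyw h
      have hca : c ≠ a := by rintro rfl; exact hay ((hinc _).2 (by simp))
      have hda : d ≠ a := by rintro rfl; exact hay ((hinc _).2 (by simp))
      rw [hE, sum_insert (by simp [hmc, hmd]), sum_insert (by simp [hcd]), sum_singleton]
      simp only [b, hm, hc, hd, hca, hda, hyv, hyw, if_true, if_false, and_false, or_self]
      norm_num

/-- A bipartite cubic graph other than a union of triple edges has a signature with two negative
edges and circular flow number four. -/
theorem exists_pair_hasFlow_four (h0 : C.IsCutCompl ∅) {e₁ e₂ : E} (h1 : C.inc e₁ v)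
    (h2 : C.inc e₂ v) (hne : C.other e₁ v ≠ C.other e₂ v) :
    ∃ X, X.card = 2 ∧ C.HasFlow X 4 ∧ ¬ C.IsCutCompl X := by
  have hbr := card_cut_ne_one_of_isCutCompl_empty h0
  have h12 : e₁ ≠ e₂ := by rintro rfl; exact hne rfl
  obtain ⟨m, hm1, hm2, hE, hmv⟩ := exists_third h1 h2 h12
  obtain ⟨M, hM, hmM⟩ := exists_isPM_mem hbr m
  have h1M : e₁ ∉ M := fun h => hm1 (hM.eq_of_mem hmM h hmv h1)
  have h2M : e₂ ∉ M := fun h => hm2 (hM.eq_of_mem hmM h hmv h2)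
  have hother : ∀ e u, e ∉ M → C.inc e u → ∃ f, f ∉ M ∧ C.inc f u ∧ f ≠ e := by
    intro e u he heu
    obtain ⟨m, a, b, hm, ha, hb, -, -, hab, -, hinc⟩ := hM.edgesAt_eq u
    by_cases hea : e = a
    · exact ⟨b, hb, (hinc b).2 (by simp), by rw [hea]; exact hab.symm⟩
    · exact ⟨a, ha, (hinc a).2 (by simp), Ne.symm hea⟩
  obtain ⟨u, hu⟩ : ∃ u, u = C.other e₁ v := ⟨_, rfl⟩
  obtain ⟨w, hw⟩ : ∃ w, w = C.other e₂ v := ⟨_, rfl⟩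
  have h1u : C.inc e₁ u := hu ▸ inc_other e₁ v
  have h2w : C.inc e₂ w := hw ▸ inc_other e₂ v
  have huv : u ≠ v := hu ▸ other_ne e₁ v
  have hwv : w ≠ v := hw ▸ other_ne e₂ v
  have huw : u ≠ w := by rw [hu, hw]; exact hne
  obtain ⟨e₀, h0M, h0u, h01⟩ := hother e₁ u h1M h1u
  obtain ⟨e₃, h3M, h3w, h32⟩ := hother e₂ w h2M h2w
  have h02 : e₀ ≠ e₂ := by
    rintro rfl
    rcases (inc_iff_of_inc h2 h2w hwv.symm).1 h0u with h | h
    · exact huv h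
    · exact huw h
  have h13 : e₁ ≠ e₃ := by
    rintro rfl
    rcases (inc_iff_of_inc h1 h1u huv.symm).1 h3w with h | h
    · exact hwv h
    · exact huw h.symm
  -- Along the edges e₀, e₁, e₂, e₃ of the 2-factor, both {e₀, e₂} and {e₁, e₃} have 4-flows. If
  -- both were cuts, the intersection of their sides at v would have cut {e₁, e₂}, and removing v
  -- from it would make the third edge m at v a bridge.
  have hf1 := hM.hasFlow_four_pair h0 h0M h1M h2M h0u h1u h1 h2 huv h01 h12 h02
  have hf2 := hM.hasFlow_four_pair h0 h1M h2M h3M h1 h2 h2w h3w hwv.symm h12 h32.symm h13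
  by_contra! hcon
  have hcut : ∀ X, X.card = 2 → C.HasFlow X 4 → ∃ T, C.cut T = X ∧ v ∈ T := by
    intro X hX hf
    obtain ⟨T, hT⟩ := h0.exists_cut_eq_symmDiff (hcon X hX hf)
    rw [← bot_eq_empty, bot_symmDiff] at hT
    by_cases hv : v ∈ T
    · exact ⟨T, hT, hv⟩
    · exact ⟨Tᶜ, by rw [cut_compl, hT], by simpa using hv⟩
  obtain ⟨T, hT, hvT⟩ := hcut _ (card_pair h02) hf1
  obtain ⟨U, hU, hvU⟩ := hcut _ (card_pair h13) hf2
  have hTmem : ∀ f, f ∈ C.cut T ↔ f = e₀ ∨ f = e₂ := by intro f; rw [hT]; simp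
  have hUmem : ∀ f, f ∈ C.cut U ↔ f = e₁ ∨ f = e₃ := by intro f; rw [hU]; simp
  have huT : u ∈ T := by
    have := hTmem e₁
    rw [mem_cut_iff h1 h1u huv.symm] at this
    grind
  have hwT : w ∉ T := by
    have := hTmem e₂
    rw [mem_cut_iff h2 h2w hwv.symm] at this
    grind
  have huU : u ∉ U := by
    have := hUmem e₁
    rw [mem_cut_iff h1 h1u huv.symm] at this
    grind
  have hwU : w ∈ U := by
    have := hUmem e₂
    rw [mem_cut_iff h2 h2w hwv.symm] at this
    grind
  have hR : C.cut (T ∩ U) = {e₁, e₂} := by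
    ext f
    have h5 := hTmem f
    have h6 := hUmem f
    simp only [mem_insert, mem_singleton]
    by_cases hf0 : f = e₀
    · subst hf0
      rw [mem_cut_iff_other h0u] at h5 ⊢
      simp only [mem_inter]
      grind
    by_cases hf1 : f = e₁
    · subst hf1
      rw [mem_cut_iff h1 h1u huv.symm]
      simp [hvT, hvU, huU]
    by_cases hf2 : f = e₂
    · subst hf2
      rw [mem_cut_iff h2 h2w hwv.symm]
      simp [hvT, hvU, hwT]
    by_cases hf3 : f = e₃
    · subst hf3
      rw [mem_cut_iff_other h3w] at h6 ⊢
      simp only [mem_inter]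
      grind
    · obtain ⟨y, hy⟩ := exists_inc (C := C) f
      rw [mem_cut_iff_other hy] at h5 h6 ⊢
      simp only [mem_inter]
      grind
  refine hbr (symmDiff (T ∩ U) {v}) ?_
  rw [cut_symmDiff, hR, cut_singleton, hE]
  refine card_eq_one.2 ⟨m, ?_⟩
  ext f
  simp only [mem_symmDiff, mem_insert, mem_singleton]
  grind

end CubicMultigraph

/-! ### Transfer of flows and flow numbers from `Graph` -/

namespace Graph

open Finset

open scoped Classical

set_option linter.unusedSectionVars false

/-- Edges are compared classically, as in the theory of `CubicMultigraph`. -/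
noncomputable local instance (priority := high) decidableEqEdge {α β : Type*} (G : Graph α β) :
    DecidableEq E(G) := fun _ _ => Classical.propDecidable _

/-- Vertices are compared classically, as in the theory of `CubicMultigraph`. -/
noncomputable local instance (priority := high) decidableEqVertex {α β : Type*} (G : Graph α β) :
    DecidableEq V(G) := fun _ _ => Classical.propDecidable _

variable {α β : Type*} {G : Graph α β} {e : β} {u v : α} {σ : β → ℤˣ} {r : ℝ}

theorem isLink_iff_inc_inc [G.Loopless] (huv : u ≠ v) :
    G.IsLink e u v ↔ G.Inc e u ∧ G.Inc e v := by
  refine ⟨fun h => ⟨h.inc_left, h.inc_right⟩, ?_⟩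
  rintro ⟨⟨w, hw⟩, h⟩
  rcases h.eq_or_eq_of_isLink hw with rfl | rfl
  · exact absurd rfl huv
  · exact hw

/-- A loopless cubic graph as an incidence structure on the types of its vertices and edges. -/
def toCubic (G : Graph α β) [G.Loopless] (hG : G.IsCubic) : CubicMultigraph V(G) E(G) where
  inc e v := G.Inc e v
  exists_ends := by
    rintro ⟨e, he⟩
    obtain ⟨x, y, hxy⟩ := G.exists_isLink_of_mem_edgeSet he
    refine ⟨⟨x, hxy.left_mem⟩, ⟨y, hxy.right_mem⟩, fun h => hxy.ne (congrArg Subtype.val h), ?_⟩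
    rintro ⟨w, hw⟩
    simp only [Subtype.mk.injEq]
    refine ⟨fun h => h.eq_or_eq_of_isLink hxy, ?_⟩
    rintro (rfl | rfl)
    · exact hxy.inc_left
    · exact hxy.inc_right
  exists_edges := by
    rintro ⟨v, hv⟩
    obtain ⟨a, b, c, hab, hac, hbc, h⟩ := Set.ncard_eq_three.1 (hG v hv)
    have hmem : ∀ x, G.Inc x v ↔ x = a ∨ x = b ∨ x = c := by
      intro x
      rw [← mem_incidenceSet, h]
      simp
    have ha := (hmem a).2 (by simp)
    have hb := (hmem b).2 (by simp)
    have hc := (hmem c).2 (by simp)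
    refine ⟨⟨a, ha.edge_mem⟩, ⟨b, hb.edge_mem⟩, ⟨c, hc.edge_mem⟩, ?_, ?_, ?_, ?_⟩
    · exact fun h => hab (congrArg Subtype.val h)
    · exact fun h => hac (congrArg Subtype.val h)
    · exact fun h => hbc (congrArg Subtype.val h)
    · rintro ⟨x, hx⟩
      simpa using hmem x

variable [G.Loopless] {hG : G.IsCubic}

@[simp] theorem toCubic_inc {e : E(G)} {v : V(G)} : (G.toCubic hG).inc e v ↔ G.Inc e v := Iff.rfl

variable [Fintype V(G)] [Fintype E(G)]

/-- The edges of `G` in a set, as a finset of the edge type. -/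
noncomputable def edgeFinsetOf (G : Graph α β) [Fintype E(G)] (X : Set β) : Finset E(G) :=
  univ.filter fun e => e.1 ∈ X

@[simp] theorem mem_edgeFinsetOf {X : Set β} {e : E(G)} : e ∈ G.edgeFinsetOf X ↔ e.1 ∈ X := by
  simp [edgeFinsetOf]

theorem image_edgeFinsetOf {X : Set β} (hX : X ⊆ E(G)) :
    Subtype.val '' (G.edgeFinsetOf X : Set E(G)) = X := by
  ext e
  simp only [Set.mem_image, mem_coe, mem_edgeFinsetOf, Subtype.exists, exists_and_left,
    exists_prop, exists_eq_right_right]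
  exact ⟨fun h => h.1, fun h => ⟨h, hX h⟩⟩

theorem edgeFinsetOf_image (Y : Finset E(G)) :
    G.edgeFinsetOf (Subtype.val '' (Y : Set E(G))) = Y := by
  ext e; simp

theorem ncard_image_val (Y : Finset E(G)) : (Subtype.val '' (Y : Set E(G))).ncard = Y.card := by
  rw [Set.ncard_image_of_injective _ Subtype.val_injective, Set.ncard_coe_finset]

theorem card_edgeFinsetOf {X : Set β} (hX : X ⊆ E(G)) : (G.edgeFinsetOf X).card = X.ncard := by
  rw [← ncard_image_val, image_edgeFinsetOf hX]

theorem incidenceSet_eq_image (v : V(G)) :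
    G.incidenceSet v = Subtype.val '' ((G.toCubic hG).edgesAt v : Set E(G)) := by
  ext e
  simp only [mem_incidenceSet, Set.mem_image, mem_coe, CubicMultigraph.mem_edgesAt, toCubic_inc,
    Subtype.exists, exists_and_left, exists_prop, exists_eq_right_right]
  exact ⟨fun h => ⟨h, h.edge_mem⟩, fun h => h.1⟩

theorem boundary_eq_sum (τ : β → α → ℤˣ) (f : β → ℝ) (v : V(G)) :
    G.boundary τ f v = ∑ e ∈ (G.toCubic hG).edgesAt v, ((τ e v : ℤ) : ℝ) * f e := by
  rw [boundary, incidenceSet_eq_image (hG := hG), finsum_mem_image Subtype.val_injective.injOn,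
    finsum_mem_coe_finset]

/-- Orientation times flow value is the half-edge value. Conversely its sign is the orientation and
its modulus, equal at both ends, the flow. -/
theorem hasNowhereZeroFlow_iff :
    G.HasNowhereZeroFlow σ r ↔ (G.toCubic hG).HasFlow (G.edgeFinsetOf (G.negEdges σ)) r := by
  have hunit : ∀ x : ℤˣ, |((x : ℤ) : ℝ)| = 1 := by
    intro x
    rcases Int.units_eq_one_or x with h | h <;> simp [h]
  have hmemN : ∀ e : E(G), e ∈ G.edgeFinsetOf (G.negEdges σ) ↔ σ e = -1 := by
    intro e; simp [negEdges]
  constructor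
  · rintro ⟨τ, hτ, f, ⟨hf, hb⟩, hf0⟩
    have hf' : ∀ e : E(G), 1 ≤ |f e| ∧ |f e| ≤ r - 1 := fun e =>
      (hf e e.2).resolve_right (hf0 e e.2)
    refine ⟨fun e v => ((τ e v : ℤ) : ℝ) * f e, ?_, ?_, ?_, ?_, ?_⟩
    · intro e v _
      rw [abs_mul, hunit, one_mul]
      exact (hf' e).1
    · intro e v _
      rw [abs_mul, hunit, one_mul]
      exact (hf' e).2
    · intro e u v hu hv huv he
      have h := hτ e u v ((isLink_iff_inc_inc (Subtype.val_injective.ne huv)).2 ⟨hu, hv⟩)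
      rw [(hmemN e).1 he, neg_neg] at h
      rcases Int.units_eq_one_or (τ e u) with h1 | h1 <;>
        rcases Int.units_eq_one_or (τ e v) with h2 | h2 <;> simp_all
    · intro e u v hu hv huv he
      have h := hτ e u v ((isLink_iff_inc_inc (Subtype.val_injective.ne huv)).2 ⟨hu, hv⟩)
      rw [hmemN] at he
      rw [(Int.units_eq_one_or _).resolve_right he] at h
      rcases Int.units_eq_one_or (τ e u) with h1 | h1 <;>
        rcases Int.units_eq_one_or (τ e v) with h2 | h2 <;> simp_all
    · intro v
      rw [← boundary_eq_sum]
      exact hb v v.2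
  · rintro ⟨g, hg⟩
    choose v₀ hv₀ using (CubicMultigraph.exists_inc (C := G.toCubic hG))
    let τ : β → α → ℤˣ := fun e v =>
      if h : e ∈ E(G) ∧ v ∈ V(G) then (if 0 < g ⟨e, h.1⟩ ⟨v, h.2⟩ then 1 else -1) else 1
    let f : β → ℝ := fun e => if h : e ∈ E(G) then |g ⟨e, h⟩ (v₀ ⟨e, h⟩)| else 0
    have hτ : ∀ (e : E(G)) (v : V(G)), τ e v = if 0 < g e v then 1 else -1 := by
      intro e v
      have h : e.1 ∈ E(G) ∧ v.1 ∈ V(G) := ⟨e.2, v.2⟩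
      simp only [τ, dif_pos h]
    have hf : ∀ e : E(G), f e = |g e (v₀ e)| := by
      intro e
      simp only [f, dif_pos e.2]
    have hg0 : ∀ (e : E(G)) (v : V(G)), G.Inc e v → g e v ≠ 0 := by
      intro e v hev h
      have := hg.one_le e v hev
      rw [h] at this
      norm_num at this
    have habs : ∀ (e : E(G)) (v : V(G)), G.Inc e v → |g e (v₀ e)| = |g e v| := by
      intro e v hev
      by_cases hv : v₀ e = v
      · rw [hv]
      by_cases he : e ∈ G.edgeFinsetOf (G.negEdges σ)
      · rw [hg.neg e _ v (hv₀ e) hev hv he]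
      · rw [hg.pos e _ v (hv₀ e) hev hv he, abs_neg]
    have hτf : ∀ (e : E(G)) (v : V(G)), G.Inc e v → ((τ e v : ℤ) : ℝ) * f e = g e v := by
      intro e v hev
      rw [hτ, hf, habs e v hev]
      rcases lt_or_gt_of_ne (hg0 e v hev) with h | h
      · simp [h.not_gt, abs_of_neg h]
      · simp [h, abs_of_pos h]
    refine ⟨τ, ?_, f, ⟨?_, ?_⟩, ?_⟩
    · intro e u v huv
      obtain ⟨e, rfl⟩ : ∃ e' : E(G), e'.1 = e := ⟨⟨e, huv.edge_mem⟩, rfl⟩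
      obtain ⟨u, rfl⟩ : ∃ u' : V(G), u'.1 = u := ⟨⟨u, huv.left_mem⟩, rfl⟩
      obtain ⟨v, rfl⟩ : ∃ v' : V(G), v'.1 = v := ⟨⟨v, huv.right_mem⟩, rfl⟩
      have hne : u ≠ v := fun h => huv.ne (congrArg Subtype.val h)
      have h0 := hg0 e v huv.inc_right
      rw [hτ, hτ]
      by_cases he : e ∈ G.edgeFinsetOf (G.negEdges σ)
      · rw [hg.neg e u v huv.inc_left huv.inc_right hne he, (hmemN e).1 he]
        split_ifs <;> simp
      · rw [hg.pos e u v huv.inc_left huv.inc_right hne he]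
        rw [hmemN] at he
        rw [(Int.units_eq_one_or _).resolve_right he]
        rcases lt_or_gt_of_ne h0 with h | h
        · simp [h, h.not_gt]
        · simp [h, h.not_gt]
    · intro e he
      left
      rw [hf ⟨e, he⟩, abs_abs]
      exact ⟨hg.one_le _ _ (hv₀ _), hg.le _ _ (hv₀ _)⟩
    · intro v hv
      rw [boundary_eq_sum (hG := hG) τ f ⟨v, hv⟩, ← hg.sum ⟨v, hv⟩]
      exact sum_congr rfl fun e he => hτf e _ (CubicMultigraph.mem_edgesAt.1 he)
    · intro e he
      rw [hf ⟨e, he⟩, abs_ne_zero]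
      exact hg0 _ _ (hv₀ _)

theorem le_circularFlowNumber {r₀ : ℝ}
    (h : ∀ r, (G.toCubic hG).HasFlow (G.edgeFinsetOf (G.negEdges σ)) r → r₀ ≤ r) :
    (r₀ : EReal) ≤ G.circularFlowNumber σ := by
  refine le_sInf ?_
  rintro x ⟨r, -, hr, rfl⟩
  exact EReal.coe_le_coe_iff.2 (h r ((hasNowhereZeroFlow_iff (hG := hG)).1 hr))

theorem circularFlowNumber_le
    (h : (G.toCubic hG).HasFlow (G.edgeFinsetOf (G.negEdges σ)) r) (hr : 2 ≤ r) :
    G.circularFlowNumber σ ≤ r :=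
  sInf_le ⟨r, hr, (hasNowhereZeroFlow_iff (hG := hG)).2 h, rfl⟩

theorem exists_hasFlow_lt (h : G.circularFlowNumber σ < (r : EReal)) :
    ∃ r' < r, (G.toCubic hG).HasFlow (G.edgeFinsetOf (G.negEdges σ)) r' := by
  obtain ⟨x, ⟨r', -, hr', rfl⟩, hlt⟩ := sInf_lt_iff.1 h
  exact ⟨r', EReal.coe_lt_coe_iff.1 hlt, (hasNowhereZeroFlow_iff (hG := hG)).1 hr'⟩

/-- Any flow with r < 4 already forces a cut complement, so attainment of the infimum is not needed
here. -/
theorem circularFlowNumber_eq_three_iff [Nonempty V(G)] {M : Finset E(G)}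
    (hM : (G.toCubic hG).IsPM M) :
    G.circularFlowNumber σ = ((3 : ℝ) : EReal) ↔
      (G.toCubic hG).IsCutCompl (G.edgeFinsetOf (G.negEdges σ)) := by
  constructor
  · intro h
    obtain ⟨r, hr, hf⟩ := exists_hasFlow_lt (hG := hG) (σ := σ) (r := 4)
      (by rw [h]; exact EReal.coe_lt_coe_iff.2 (by norm_num))
    exact hf.isCutCompl hr
  · intro h
    exact le_antisymm (circularFlowNumber_le (hG := hG) (hM.hasFlow_three h) (by norm_num))
      (le_circularFlowNumber (hG := hG) fun r hr => hr.three_le)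

/-- The infimum is attained, which gives the 4-flow; without a cut complement no r < 4 is possible.
-/
theorem circularFlowNumber_eq_four_iff [Nonempty V(G)] {M : Finset E(G)}
    (hM : (G.toCubic hG).IsPM M) :
    G.circularFlowNumber σ = ((4 : ℝ) : EReal) ↔
      (G.toCubic hG).HasFlow (G.edgeFinsetOf (G.negEdges σ)) 4 ∧
      ¬ (G.toCubic hG).IsCutCompl (G.edgeFinsetOf (G.negEdges σ)) := by
  constructor
  · intro h
    refine ⟨CubicMultigraph.hasFlow_of_forall_lt fun r hr => exists_hasFlow_lt ?_, fun hc => ?_⟩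
    · rw [h]
      exact EReal.coe_lt_coe_iff.2 hr
    · rw [(circularFlowNumber_eq_three_iff hM).2 hc, EReal.coe_eq_coe_iff] at h
      norm_num at h
  · rintro ⟨hf, hc⟩
    refine le_antisymm (circularFlowNumber_le (hG := hG) hf (by norm_num))
      (le_circularFlowNumber (hG := hG) fun r hr => ?_)
    by_contra hlt
    exact hc (hr.isCutCompl (not_le.1 hlt))

/-! ### Smallest minimal sets as sets of minimum cardinality -/

section Smallest

variable {P : Finset E(G) → Prop}

theorem exists_negEdges_eq (Y : Finset E(G)) :
    ∃ σ : β → ℤˣ, G.negEdges σ = Subtype.val '' (Y : Set E(G)) := by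
  refine ⟨fun e => if e ∈ Subtype.val '' (Y : Set E(G)) then -1 else 1, ?_⟩
  ext e
  simp only [negEdges, Set.mem_ofPred_eq]
  split_ifs with h
  · refine ⟨fun _ => h, fun _ => ⟨?_, rfl⟩⟩
    obtain ⟨e, -, rfl⟩ := h
    exact e.2
  · exact ⟨fun h' => absurd h'.2 (by decide), fun h' => absurd h' h⟩

theorem negEdges_subset (σ : β → ℤˣ) : G.negEdges σ ⊆ E(G) := fun _ he => he.1

/-- A set of minimum cardinality is automatically minimal under inclusion. -/
theorem isSmallestMinimalSet_image
    (hP : ∀ σ, G.circularFlowNumber σ = (r : EReal) ↔ P (G.edgeFinsetOf (G.negEdges σ)))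
    {Y : Finset E(G)} (hY : P Y) (hmin : ∀ Y', P Y' → Y.card ≤ Y'.card) :
    G.IsSmallestMinimalSet r (Subtype.val '' (Y : Set E(G))) := by
  obtain ⟨σ, hσ⟩ := exists_negEdges_eq Y
  refine ⟨⟨⟨σ, ?_, hσ⟩, ?_⟩, ?_⟩
  · rw [hP, hσ, edgeFinsetOf_image]
    exact hY
  · intro σ' hlt h
    have h1 := hmin _ ((hP σ').1 h)
    have h2 := Set.ncard_lt_ncard hlt (Set.toFinite _)
    rw [ncard_image_val, ← card_edgeFinsetOf (negEdges_subset σ')] at h2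
    omega
  · rintro X' ⟨⟨σ', h, rfl⟩, -⟩
    rw [ncard_image_val, ← card_edgeFinsetOf (negEdges_subset σ')]
    exact hmin _ ((hP σ').1 h)

theorem exists_min_card (h : ∃ Y, P Y) : ∃ Y, P Y ∧ ∀ Y', P Y' → Y.card ≤ Y'.card := by
  obtain ⟨Y₀, hY₀⟩ := h
  obtain ⟨Y, hY, hmin⟩ := exists_min_image (univ.filter P) card ⟨Y₀, by simpa using hY₀⟩
  exact ⟨Y, by simpa using hY, fun Y' hY' => hmin Y' (by simpa using hY')⟩

theorem exists_isSmallestMinimalSet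
    (hP : ∀ σ, G.circularFlowNumber σ = (r : EReal) ↔ P (G.edgeFinsetOf (G.negEdges σ)))
    (h : ∃ Y, P Y) : ∃ X, G.IsSmallestMinimalSet r X := by
  obtain ⟨Y, hY, hmin⟩ := exists_min_card h
  exact ⟨_, isSmallestMinimalSet_image hP hY hmin⟩

/-- Minimality over all sets with P, not only the r-minimal ones, holds because a set of minimum
cardinality is itself r-minimal. -/
theorem IsSmallestMinimalSet.exists_finset
    (hP : ∀ σ, G.circularFlowNumber σ = (r : EReal) ↔ P (G.edgeFinsetOf (G.negEdges σ)))
    {X : Set β} (hX : G.IsSmallestMinimalSet r X) :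
    ∃ Y, Y.card = X.ncard ∧ P Y ∧ ∀ Y', P Y' → Y.card ≤ Y'.card := by
  obtain ⟨⟨⟨σ, h, rfl⟩, -⟩, hmin⟩ := hX
  have hY := (hP σ).1 h
  have hc := card_edgeFinsetOf (negEdges_subset (G := G) σ)
  refine ⟨_, hc, hY, fun Y' hY' => ?_⟩
  obtain ⟨Z, hZ, hZmin⟩ := exists_min_card ⟨_, hY⟩
  have h1 := hmin _ (isSmallestMinimalSet_image hP hZ hZmin).1
  rw [ncard_image_val] at h1
  rw [hc]
  exact h1.trans (hZmin Y' hY')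

end Smallest

/-! ### Oddness, resistance, bridges and components in the incidence model -/

theorem toSimpleGraph_eq : G.toSimpleGraph = (G.toCubic hG).factorGraph univ := by
  ext u v
  rw [toSimpleGraph_adj]
  refine and_congr_right fun huv => ?_
  have hne : u.1 ≠ v.1 := Subtype.val_injective.ne huv
  constructor
  · rintro ⟨e, he⟩
    exact ⟨⟨e, he.edge_mem⟩, mem_univ _, he.inc_left, he.inc_right⟩
  · rintro ⟨e, -, hu, hv⟩
    exact ⟨e, (isLink_iff_inc_inc hne).2 ⟨hu, hv⟩⟩

theorem numOddCircuits_eq (F : Set β) :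
    G.numOddCircuits F = ((G.toCubic hG).factorGraph (G.edgeFinsetOf F)).oddComponents.ncard := by
  have h : (G.restrict F).toSimpleGraph = (G.toCubic hG).factorGraph (G.edgeFinsetOf F) := by
    ext u v
    rw [toSimpleGraph_adj]
    refine and_congr_right fun huv => ?_
    have hne : u.1 ≠ v.1 := Subtype.val_injective.ne huv
    constructor
    · rintro ⟨e, heF, he⟩
      exact ⟨⟨e, he.edge_mem⟩, mem_edgeFinsetOf.2 heF, he.inc_left, he.inc_right⟩
    · rintro ⟨e, heF, hu, hv⟩
      exact ⟨e, mem_edgeFinsetOf.1 heF, (isLink_iff_inc_inc hne).2 ⟨hu, hv⟩⟩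
  rw [numOddCircuits, h]
  rfl

theorem ncard_incidenceSet_inter (F : Set β) (v : V(G)) :
    (G.incidenceSet v ∩ F).ncard = ((G.toCubic hG).edgesAt v ∩ G.edgeFinsetOf F).card := by
  rw [← ncard_image_val]
  congr 1
  ext e
  simp only [Set.mem_inter_iff, mem_incidenceSet, coe_inter, Set.mem_image, mem_coe,
    CubicMultigraph.mem_edgesAt, toCubic_inc, mem_edgeFinsetOf, Subtype.exists, exists_and_left,
    exists_prop, exists_eq_right_right]
  exact ⟨fun h => ⟨h, h.1.edge_mem⟩, fun h => h.1⟩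

theorem isPM_iff_card {M : Finset E(G)} :
    (G.toCubic hG).IsPM M ↔ ∀ v, ((G.toCubic hG).edgesAt v ∩ M).card = 1 := by
  refine forall_congr' fun v => ?_
  rw [card_eq_one]
  constructor
  · rintro ⟨e, he, h⟩
    refine ⟨e, ?_⟩
    ext f
    simp only [mem_inter, CubicMultigraph.mem_edgesAt, mem_singleton]
    exact ⟨fun hf => h f ⟨hf.2, hf.1⟩, fun hf => hf ▸ ⟨he.2, he.1⟩⟩
  · rintro ⟨e, he⟩
    have hmem : ∀ f, ((G.toCubic hG).inc f v ∧ f ∈ M) ↔ f = e := by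
      intro f
      rw [← CubicMultigraph.mem_edgesAt, ← mem_inter, he, mem_singleton]
    exact ⟨e, ((hmem e).2 rfl).symm, fun f hf => (hmem f).1 hf.symm⟩

theorem IsFactor.isPM {F : Set β} (hF : G.IsFactor 1 F) :
    (G.toCubic hG).IsPM (G.edgeFinsetOf F) := by
  rw [isPM_iff_card]
  intro v
  rw [← ncard_incidenceSet_inter]
  exact hF.2 v v.2

theorem IsFactor.isPM_compl {F : Set β} (hF : G.IsFactor 2 F) :
    (G.toCubic hG).IsPM (G.edgeFinsetOf F)ᶜ := by
  rw [isPM_iff_card]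
  intro v
  have h1 := hF.2 v v.2
  rw [ncard_incidenceSet_inter (hG := hG)] at h1
  have h2 := card_sdiff_add_card_inter ((G.toCubic hG).edgesAt v) (G.edgeFinsetOf F)
  rw [CubicMultigraph.card_edgesAt, sdiff_eq_inter_compl, h1] at h2
  omega

theorem oddness_le {M : Finset E(G)} (hM : (G.toCubic hG).IsPM M) :
    G.oddness ≤ ((G.toCubic hG).factorGraph Mᶜ).oddComponents.ncard := by
  refine Nat.sInf_le ⟨Subtype.val '' ((Mᶜ : Finset E(G)) : Set E(G)), ⟨?_, ?_⟩, ?_⟩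
  · rintro _ ⟨e, -, rfl⟩
    exact e.2
  · intro v hv
    rw [ncard_incidenceSet_inter (hG := hG) _ ⟨v, hv⟩, edgeFinsetOf_image]
    exact hM.card_edgesAt_inter_compl _
  · rw [numOddCircuits_eq (hG := hG), edgeFinsetOf_image]

theorem exists_isPM_oddness_eq {M : Finset E(G)} (hM : (G.toCubic hG).IsPM M) :
    ∃ M', (G.toCubic hG).IsPM M' ∧
      G.oddness = ((G.toCubic hG).factorGraph M'ᶜ).oddComponents.ncard := by
  have hne : {n | ∃ F, G.IsFactor 2 F ∧ n = G.numOddCircuits F}.Nonempty := by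
    refine ⟨_, Subtype.val '' ((Mᶜ : Finset E(G)) : Set E(G)), ⟨?_, ?_⟩, rfl⟩
    · rintro _ ⟨e, -, rfl⟩
      exact e.2
    · intro v hv
      rw [ncard_incidenceSet_inter (hG := hG) _ ⟨v, hv⟩, edgeFinsetOf_image]
      exact hM.card_edgesAt_inter_compl _
  obtain ⟨F, hF, h⟩ := Nat.sInf_mem hne
  refine ⟨(G.edgeFinsetOf F)ᶜ, hF.isPM_compl, ?_⟩
  rw [compl_compl, ← numOddCircuits_eq]
  exact h

theorem edgeColorable_iff {k : ℕ} : G.EdgeColorable (k + 1) ↔ ∃ c : E(G) → Fin (k + 1),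
    ∀ e f v, (G.toCubic hG).inc e v → (G.toCubic hG).inc f v → e ≠ f → c e ≠ c f := by
  constructor
  · rintro ⟨c, hc⟩
    exact ⟨fun e => c e, fun e f v he hf hef => hc e f v he hf (Subtype.val_injective.ne hef)⟩
  · rintro ⟨c, hc⟩
    refine ⟨fun e => if h : e ∈ E(G) then c ⟨e, h⟩ else 0, ?_⟩
    intro e f v he hf hef
    simp only [he.edge_mem, hf.edge_mem, dif_pos]
    exact hc ⟨e, he.edge_mem⟩ ⟨f, hf.edge_mem⟩ ⟨v, he.vertex_mem⟩ he hf (by simpa using hef)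

theorem resistance_le {N : Finset E(G)} {c : E(G) → Fin 4}
    (hc : ∀ e f v, (G.toCubic hG).inc e v → (G.toCubic hG).inc f v → e ≠ f → c e ≠ c f)
    (hN : ∀ e, c e = 3 ↔ e ∈ N) : G.resistance ≤ N.card := by
  let c' : β → Fin 4 := fun e => if h : e ∈ E(G) then c ⟨e, h⟩ else 0
  have hc' : ∀ e (h : e ∈ E(G)), c' e = c ⟨e, h⟩ := fun e h => by simp only [c', dif_pos h]
  refine Nat.sInf_le ⟨c', ?_, 3, ?_⟩
  · intro e f v he hf hef
    rw [hc' e he.edge_mem, hc' f hf.edge_mem]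
    exact hc ⟨e, he.edge_mem⟩ ⟨f, hf.edge_mem⟩ ⟨v, he.vertex_mem⟩ he hf (by simpa using hef)
  · rw [← ncard_image_val]
    congr 1
    ext e
    constructor
    · rintro ⟨e, he, rfl⟩
      exact ⟨e.2, (hc' _ e.2).trans ((hN e).2 he)⟩
    · rintro ⟨he, h⟩
      exact ⟨⟨e, he⟩, (hN _).1 ((hc' e he).symm.trans h), rfl⟩

/-- The fourth colour is reserved for negative edges and is unused when there are none. -/
theorem edgeColorable_of_hasFlow_empty (h : (G.toCubic hG).HasFlow ∅ 4) : G.EdgeColorable 3 := by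
  obtain ⟨c, hc, hc3⟩ := h.exists_coloring (by simp)
  have hlt : ∀ e, (c e : ℕ) < 3 := by
    intro e
    have : c e ≠ 3 := fun h => by simpa using (hc3 e).1 h
    omega
  refine (edgeColorable_iff (hG := hG)).2 ⟨fun e => ⟨c e, hlt e⟩, fun e f v he hf hef h => ?_⟩
  refine hc e f v he hf hef (Fin.ext ?_)
  simpa using h

/-- Membership in S is invariant along every edge but the single cut edge, so deleting that edge
disconnects its ends. -/
theorem card_cut_ne_one_of_forall_not_isBridge (h : ∀ e, ¬ G.IsBridge e) (S : Finset V(G)) :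
    ((G.toCubic hG).cut S).card ≠ 1 := by
  intro h1
  obtain ⟨e, he⟩ := card_eq_one.1 h1
  refine h e ⟨e.2, fun u v huv hr => ?_⟩
  have hmem : ∀ x y f, ∀ hl : G.IsLink f x y, f ≠ e.1 →
      ((∃ h, (⟨x, h⟩ : V(G)) ∈ S) ↔ ∃ h, (⟨y, h⟩ : V(G)) ∈ S) := by
    intro x y f hl hf
    have hfc : (⟨f, hl.edge_mem⟩ : E(G)) ∉ (G.toCubic hG).cut S := by
      rw [he, mem_singleton]
      exact fun h => hf (congrArg Subtype.val h)
    rw [CubicMultigraph.mem_cut_iff (u := ⟨x, hl.left_mem⟩) (v := ⟨y, hl.right_mem⟩)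
      hl.inc_left hl.inc_right (fun h => hl.ne (congrArg Subtype.val h)), not_not] at hfc
    simpa [hl.left_mem, hl.right_mem] using hfc
  have hinv : (∃ h, (⟨u, h⟩ : V(G)) ∈ S) ↔ ∃ h, (⟨v, h⟩ : V(G)) ∈ S := by
    clear huv
    induction hr with
    | refl => exact Iff.rfl
    | tail _ hadj ih =>
      refine ih.trans ?_
      obtain ⟨f, hf⟩ := hadj
      rw [← restrict_edgeSet_sdiff_eq_deleteEdges, restrict_isLink] at hf
      exact hmem _ _ f hf.2 (by simpa using hf.1.2)
  have hec : e ∈ (G.toCubic hG).cut S := by rw [he]; exact mem_singleton_self e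
  rw [CubicMultigraph.mem_cut_iff (u := ⟨u, huv.left_mem⟩) (v := ⟨v, huv.right_mem⟩)
    huv.inc_left huv.inc_right (fun h => huv.ne (congrArg Subtype.val h))] at hec
  exact hec (by simpa [huv.left_mem, huv.right_mem] using hinv)

/-- In a component other than a triple edge, every vertex has two distinct neighbours. -/
theorem exists_other_ne {x : α} (hx : x ∈ V(G))
    (hK : ∀ H : Graph α β, H ≤c G → x ∈ V(H) → ¬ H.IsK23) :
    ∃ e₁ e₂ v, (G.toCubic hG).inc e₁ v ∧ (G.toCubic hG).inc e₂ v ∧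
      (G.toCubic hG).other e₁ v ≠ (G.toCubic hG).other e₂ v := by
  by_contra! hcon
  obtain ⟨a, _, _, -, -, -, hinc⟩ := (G.toCubic hG).exists_edges ⟨x, hx⟩
  have hax := (hinc a).2 (by simp)
  obtain ⟨y, hy⟩ : ∃ y, y = (G.toCubic hG).other a ⟨x, hx⟩ := ⟨_, rfl⟩
  have hxy : x ≠ y.1 := by
    intro h
    exact CubicMultigraph.other_ne (C := G.toCubic hG) a ⟨x, hx⟩ (hy ▸ Subtype.ext h.symm)
  have hlink : ∀ e, G.Inc e x → G.IsLink e x y := by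
    intro e he
    refine (isLink_iff_inc_inc hxy).2 ⟨he, ?_⟩
    have h1 := hcon ⟨e, he.edge_mem⟩ a ⟨x, hx⟩ he hax
    have h2 := CubicMultigraph.inc_other (C := G.toCubic hG) ⟨e, he.edge_mem⟩ ⟨x, hx⟩
    rw [h1, ← hy] at h2
    exact h2
  have hsub : G.incidenceSet x ⊆ G.incidenceSet y := fun e he => (hlink e he).inc_right
  have hfin : (G.incidenceSet y).Finite :=
    (Set.toFinite E(G)).subset (G.incidenceSet_subset_edgeSet _)
  have heq : G.incidenceSet x = G.incidenceSet y :=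
    Set.eq_of_subset_of_ncard_le hsub (by rw [hG x hx, hG y y.2]) hfin
  -- All three edges at x lead to y and exhaust the edges at y, so they form a whole component.
  refine hK (banana x y (G.incidenceSet x)) ?_ (by simp) ⟨x, y, hxy, ?_, ?_⟩
  · refine IsClosedSubgraph.mk' ⟨?_, ?_⟩ ?_
    · rintro z hz
      simp only [vertexSet_banana, Set.mem_insert_iff, Set.mem_singleton_iff] at hz
      rcases hz with rfl | rfl
      · exact hx
      · exact y.2
    · intro e u v huv
      rw [banana_isLink] at huv
      obtain ⟨he, ⟨rfl, rfl⟩ | ⟨rfl, rfl⟩⟩ := huv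
      · exact hlink e he
      · exact (hlink e he).symm
    · intro e z hez hz
      simp only [vertexSet_banana, Set.mem_insert_iff, Set.mem_singleton_iff] at hz
      rw [edgeSet_banana]
      rcases hz with rfl | rfl
      · exact hez
      · rw [heq]
        exact hez
  · rw [edgeSet_banana]
    exact hG x hx
  · rw [edgeSet_banana]

variable {N : Finset E(G)}

theorem isBipartite_iff : G.toSimpleGraph.IsBipartite ↔ (G.toCubic hG).IsCutCompl ∅ := by
  rw [toSimpleGraph_eq (hG := hG), CubicMultigraph.isCutCompl_empty_iff_isBipartite]

/-! ### Existence for 4, the bounds and the theorem -/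

/-- A signature with circular flow number four exists. -/
theorem exists_hasFlow_four_not_isCutCompl {M : Finset E(G)} (hM : (G.toCubic hG).IsPM M)
    {x : α} (hx : x ∈ V(G))
    (hK : ∀ H : Graph α β, H ≤c G → x ∈ V(H) → ¬ H.IsK23) :
    ∃ X, ((G.toCubic hG).HasFlow X 4 ∧ ¬ (G.toCubic hG).IsCutCompl X) ∧
      (G.toSimpleGraph.IsBipartite → X.card = 2) ∧
      (G.EdgeColorable 3 → ¬ G.toSimpleGraph.IsBipartite → X.card = 0) ∧
      (¬ G.EdgeColorable 3 → X.card ≤ G.oddness) := by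
  by_cases hb : G.toSimpleGraph.IsBipartite
  · have hb' := (isBipartite_iff (hG := hG)).1 hb
    have hcol : G.EdgeColorable 3 :=
      edgeColorable_of_hasFlow_empty ((hM.hasFlow_three hb').mono (by norm_num))
    obtain ⟨e₁, e₂, v, h1, h2, hne⟩ := exists_other_ne (hG := hG) hx hK
    obtain ⟨X, hX, hf, hc⟩ := CubicMultigraph.exists_pair_hasFlow_four hb' h1 h2 hne
    exact ⟨X, ⟨hf, hc⟩, fun _ => hX, fun _ h => absurd hb h, fun h => absurd hcol h⟩
  by_cases hcol : G.EdgeColorable 3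
  · obtain ⟨c, hc⟩ := (edgeColorable_iff (hG := hG)).1 hcol
    exact ⟨∅, ⟨CubicMultigraph.hasFlow_empty_of_coloring hc,
      fun h => hb ((isBipartite_iff (hG := hG)).2 h)⟩, fun h => absurd h hb, fun _ _ => rfl,
      fun h => absurd hcol h⟩
  · obtain ⟨M', hM', hodd⟩ := exists_isPM_oddness_eq hM
    by_cases hne : ((G.toCubic hG).factorGraph M'ᶜ).oddComponents.Nonempty
    · obtain ⟨X, hf, hc, hle⟩ := hM'.exists_hasFlow_four_not_isCutCompl hne
      exact ⟨X, ⟨hf, hc⟩, fun h => absurd h hb, fun h => absurd h hcol,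
        fun _ => hle.trans_eq hodd.symm⟩
    -- Without odd circuits the negative set is empty, so the 4-flow would give a 3-edge-colouring.
    · have : Nonempty V(G) := ⟨⟨x, hx⟩⟩
      obtain ⟨X, hf, hle⟩ := hM'.exists_hasFlow_four
      rw [Set.not_nonempty_iff_eq_empty.1 hne, Set.ncard_empty, Nat.le_zero, card_eq_zero] at hle
      exact absurd (edgeColorable_of_hasFlow_empty (hle ▸ hf)) hcol

/-- Switching preserves both properties, so minimality makes N a matching, as the colouring lemma
requires. -/
theorem resistance_le_of_min (hf : (G.toCubic hG).HasFlow N 4)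
    (hc : ¬ (G.toCubic hG).IsCutCompl N)
    (hmin : ∀ N', (G.toCubic hG).HasFlow N' 4 ∧ ¬ (G.toCubic hG).IsCutCompl N' →
      N.card ≤ N'.card) : G.resistance ≤ N.card := by
  obtain ⟨c, hc, hN⟩ := hf.exists_coloring fun v =>
    CubicMultigraph.card_inter_edgesAt_le_one_of_card_le v
      (hmin _ ⟨hf.switch v, fun h => hc ((CubicMultigraph.isCutCompl_switch_iff v).1 h)⟩)
  exact resistance_le hc hN

theorem two_mul_card_le_of_min (hc : (G.toCubic hG).IsCutCompl N)
    (hmin : ∀ N', (G.toCubic hG).IsCutCompl N' → N.card ≤ N'.card) :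
    2 * N.card ≤ V(G).ncard := by
  rw [← Nat.card_coe_set_eq, Nat.card_eq_fintype_card]
  exact CubicMultigraph.two_mul_card_le_of_matching fun v =>
    CubicMultigraph.card_inter_edgesAt_le_one_of_card_le v (hmin _ (hc.switch v))

theorem card_add_indepNum_le_of_min
    (hmin : ∀ N', (G.toCubic hG).IsCutCompl N' → N.card ≤ N'.card) :
    2 * N.card + 6 * G.toSimpleGraph.indepNum ≤ 3 * V(G).ncard := by
  rw [← Nat.card_coe_set_eq, Nat.card_eq_fintype_card]
  obtain ⟨S, hS⟩ := G.toSimpleGraph.exists_isNIndepSet_indepNum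
  have h1 := hS.isIndepSet
  rw [toSimpleGraph_eq (hG := hG)] at h1
  obtain ⟨N', hN', h⟩ := CubicMultigraph.exists_isCutCompl_of_isIndepSet h1
  have h2 := hmin N' hN'
  have h3 := hS.card_eq
  omega

theorem oddness_le_card {M : Finset E(G)} (hM : (G.toCubic hG).IsPM M)
    (hc : (G.toCubic hG).IsCutCompl N) : G.oddness ≤ N.card :=
  ((oddness_le hM).trans (hc.ncard_oddComponents_le hM)).trans (card_le_card sdiff_subset)

/-- The odd circuits of the complement of M already need that many edges of N outside M, and e is
one more. -/
theorem oddness_lt_card {M : Finset E(G)} (hM : (G.toCubic hG).IsPM M)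
    (hc : (G.toCubic hG).IsCutCompl N) {e : E(G)} (heN : e ∈ N) (heM : e ∈ M) :
    G.oddness < N.card := by
  refine ((oddness_le hM).trans (hc.ncard_oddComponents_le hM)).trans_lt
    (card_lt_card ⟨sdiff_subset, fun h => ?_⟩)
  exact (mem_sdiff.1 (h heN)).2 heM

end Graph

theorem theorem5p8 {α β : Type*} (G : Graph α β) [G.Loopless]
    (hV : V(G).Finite) (hE : E(G).Finite) (hcubic : G.IsCubic)
    (hfactor : ∃ F, G.IsFactor 1 F)
    -- some connected component of `G` is not `K_2^3`; for connected `G`: `G` is not `K_2^3`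
    (hK : ∃ x ∈ V(G), ∀ H : Graph α β, H ≤c G → x ∈ V(H) → ¬ H.IsK23) :
    (∃ X₃, G.IsSmallestMinimalSet 3 X₃) ∧ (∃ X₄, G.IsSmallestMinimalSet 4 X₄) ∧
    ∀ X₃ X₄ : Set β, G.IsSmallestMinimalSet 3 X₃ → G.IsSmallestMinimalSet 4 X₄ →
      (G.toSimpleGraph.IsBipartite → X₃.ncard = 0 ∧ X₄.ncard = 2) ∧
      (G.EdgeColorable 3 → ¬ G.toSimpleGraph.IsBipartite →
        2 ≤ X₃.ncard ∧
        (X₃.ncard : ℝ) ≤ 3 * ((V(G).ncard : ℝ) / 2 - (G.toSimpleGraph.indepNum : ℝ)) ∧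
        X₄.ncard = 0) ∧
      (¬ G.EdgeColorable 3 →
        G.resistance ≤ X₄.ncard ∧ X₄.ncard ≤ G.oddness ∧ G.oddness ≤ X₃.ncard ∧
        (X₃.ncard : ℝ) ≤ min (3 * ((V(G).ncard : ℝ) / 2 - (G.toSimpleGraph.indepNum : ℝ)))
          ((V(G).ncard : ℝ) / 2)) ∧
      (G.IsSnark →
        G.resistance ≤ X₄.ncard ∧ X₄.ncard ≤ G.oddness ∧ G.oddness < X₃.ncard ∧
        (X₃.ncard : ℝ) ≤ min (3 * ((V(G).ncard : ℝ) / 2 - (G.toSimpleGraph.indepNum : ℝ)))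
          ((V(G).ncard : ℝ) / 2)) := by
  have := hV.fintype
  have := hE.fintype
  obtain ⟨x, hx, hK⟩ := hK
  have : Nonempty V(G) := ⟨⟨x, hx⟩⟩
  obtain ⟨F, hF⟩ := hfactor
  have hM := hF.isPM (hG := hcubic)
  have hP3 := fun σ => Graph.circularFlowNumber_eq_three_iff (σ := σ) hM
  have hP4 := fun σ => Graph.circularFlowNumber_eq_four_iff (σ := σ) hM
  obtain ⟨Z, hZ, hZb, hZc, hZn⟩ := Graph.exists_hasFlow_four_not_isCutCompl hM hx hK
  refine ⟨Graph.exists_isSmallestMinimalSet hP3 ⟨_, ∅, rfl⟩,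
    Graph.exists_isSmallestMinimalSet
      (P := fun N => (G.toCubic hcubic).HasFlow N 4 ∧ ¬ (G.toCubic hcubic).IsCutCompl N)
      hP4 ⟨Z, hZ⟩, fun X₃ X₄ h3 h4 => ?_⟩
  obtain ⟨Y₃, hY3, hc3, hmin3⟩ := h3.exists_finset hP3
  obtain ⟨Y₄, hY4, ⟨hf4, hc4⟩, hmin4⟩ := h4.exists_finset
    (P := fun N => (G.toCubic hcubic).HasFlow N 4 ∧ ¬ (G.toCubic hcubic).IsCutCompl N) hP4
  rw [← hY3, ← hY4]
  have hZ4 := hmin4 Z hZ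
  have hres := Graph.resistance_le_of_min hf4 hc4 hmin4
  have hhalf : (Y₃.card : ℝ) ≤ (V(G).ncard : ℝ) / 2 := by
    have : (2 * Y₃.card : ℝ) ≤ V(G).ncard := by
      exact_mod_cast Graph.two_mul_card_le_of_min hc3 hmin3
    linarith
  have hindep : (Y₃.card : ℝ) ≤
      3 * ((V(G).ncard : ℝ) / 2 - (G.toSimpleGraph.indepNum : ℝ)) := by
    have : (2 * Y₃.card + 6 * G.toSimpleGraph.indepNum : ℝ) ≤ 3 * V(G).ncard := by
      exact_mod_cast Graph.card_add_indepNum_le_of_min hmin3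
    linarith
  refine ⟨fun hb => ⟨?_, ?_⟩, fun hcol hb => ⟨?_, hindep, ?_⟩, fun hcol =>
    ⟨hres, hZ4.trans (hZn hcol), Graph.oddness_le_card hM hc3, le_min hindep hhalf⟩,
    fun hs => ⟨hres, hZ4.trans (hZn hs.2.2), ?_, le_min hindep hhalf⟩⟩
  · simpa using hmin3 ∅ (Graph.isBipartite_iff.1 hb)
  · have h0 : Y₄.card ≠ 0 := by
      intro h
      rw [Finset.card_eq_zero] at h
      exact hc4 (h ▸ Graph.isBipartite_iff.1 hb)
    have h1 := hf4.card_ne_one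
    have h2 := hZb hb
    omega
  · have h0 : Y₃.card ≠ 0 := by
      intro h
      rw [Finset.card_eq_zero] at h
      exact hb (Graph.isBipartite_iff.2 (h ▸ hc3))
    have h1 := hc3.card_ne_one
    omega
  · have := hZc hcol hb
    omega
  -- If the empty set were a cut complement, its 3-flow would also be a 4-flow and give a
  -- 3-edge-colouring. So there is an edge of Y₃, through which a new 1-factor is taken.
  · have hne : Y₃.Nonempty := by
      rw [Finset.nonempty_iff_ne_empty]
      intro h
      exact hs.2.2 (Graph.edgeColorable_of_hasFlow_empty
        ((hM.hasFlow_three (h ▸ hc3)).mono (by norm_num)))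
    obtain ⟨e, he⟩ := hne
    obtain ⟨M, hM', heM⟩ := CubicMultigraph.exists_isPM_mem
      (Graph.card_cut_ne_one_of_forall_not_isBridge (hG := hcubic) hs.2.1) e
    exact Graph.oddness_lt_card hM' hc3 he heM
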